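/- Let $R$ be a (possibly noncommutative, unital) ring that is quasi-Frobenius (a qF-ring), i.e. $R$ is right artinian and injective as a right $R$-module. Let $\mathcal C=(\mathcal C,\Delta,\varepsilon)$ be an $R$-coring, i.e. an $R$-bimodule with coassociative and counital $R$-bimodule maps $\Delta:\mathcal C\to\mathcal C\otimes_R\mathcal C$ and $\varepsilon:\mathcal C\to R$, and assume that $\mathcal C$ is projective both as a left and as a right $R$-module. Assume that $\mathcal C$ is right semiperfect: it satisfies the left $\alpha$-condition (for every right $R$-module $N$ the map $N\otimes_R\mathcal C\to \mathrm{Hom}_R({}_R\mathrm{Hom}(\mathcal C,R),N)$, $n\otimes c\mapsto (f\mapsto n f(c))$, is injective), and every simple right $\mathcal C$-comodule $S$ has a projective cover, i.e. there are a projective object $P$ of the category of right $\mathcal C$-comodules and a surjective colinear map $f:P\to S$ such that a subcomodule $L\subseteq P$ with $\ker f+L=P$ equals $P$. Then every nonzero left $\mathcal C$-comodule $M$ has a maximal (proper) subcomodule. Consequently, its Jacobson radical $J(M)$, the intersection of all maximal subcomodules of $M$, is small in $M$: $J(M)$ is a subcomodule, and every subcomodule $L\subseteq M$ with $J(M)+L=M$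 equals $M$. -/

import Mathlib

open MulOpposite

universe u

namespace CoringTheory

/-! ### Tensor products over a possibly noncommutative ring

A right `R`-module is a module over `Rᵐᵒᵖ`, with `m * r = op r • m`. -/

section BTensor

variable (R M N : Type u) [Ring R] [AddCommGroup M] [Module Rᵐᵒᵖ M] [AddCommGroup N] [Module R N]

/-- The subgroup of `M ⊗[ℤ] N` generated by the elements `m r ⊗ n - m ⊗ r n`. -/
def balancer : AddSubgroup (TensorProduct ℤ M N) :=
  AddSubgroup.closure {x | ∃ (r : R) (m : M) (n : N),
    x = TensorProduct.tmul ℤ (op r • m) n - TensorProduct.tmul ℤ m (r • n)}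

/-- The tensor product `M ⊗_R N` of a right `R`-module `M` and a left `R`-module `N`. -/
def BTensor : Type u := TensorProduct ℤ M N ⧸ balancer R M N

noncomputable instance : AddCommGroup (BTensor R M N) :=
  inferInstanceAs (AddCommGroup (TensorProduct ℤ M N ⧸ balancer R M N))

end BTensor

namespace BTensor

section Basic

variable (R : Type u) {M N P : Type u} [Ring R] [AddCommGroup M] [Module Rᵐᵒᵖ M]
  [AddCommGroup N] [Module R N] [AddCommGroup P]

variable (M N) in
/-- The projection `M ⊗[ℤ] N → M ⊗_R N`. -/
noncomputable def proj : TensorProduct ℤ M N →+ BTensor R M N :=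
  QuotientAddGroup.mk' (balancer R M N)

theorem proj_surjective : Function.Surjective (proj R M N) :=
  QuotientAddGroup.mk'_surjective (balancer R M N)

/-- The pure tensor `m ⊗ n` in `M ⊗_R N`. -/
noncomputable def tmul (m : M) (n : N) : BTensor R M N :=
  proj R M N (TensorProduct.tmul ℤ m n)

theorem smul_tmul (r : R) (m : M) (n : N) : tmul R (op r • m) n = tmul R m (r • n) := by
  rw [tmul, tmul, ← sub_eq_zero, ← map_sub]
  exact (QuotientAddGroup.eq_zero_iff _).2 (AddSubgroup.subset_closure ⟨r, m, n, rfl⟩)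

theorem add_tmul (m m' : M) (n : N) : tmul R (m + m') n = tmul R m n + tmul R m' n := by
  simp only [tmul, TensorProduct.add_tmul, map_add]

theorem tmul_add (m : M) (n n' : N) : tmul R m (n + n') = tmul R m n + tmul R m n' := by
  simp only [tmul, TensorProduct.tmul_add, map_add]

theorem zero_tmul (n : N) : tmul R (0 : M) n = 0 := by
  simp only [tmul, TensorProduct.zero_tmul, map_zero]

theorem tmul_zero (m : M) : tmul R m (0 : N) = 0 := by
  simp only [tmul, TensorProduct.tmul_zero, map_zero]

/-- The biadditive map `(m, n) ↦ m ⊗ n`. -/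
noncomputable def mk : M →+ N →+ BTensor R M N :=
  AddMonoidHom.mk' (fun m => AddMonoidHom.mk' (fun n => tmul R m n) (tmul_add R m))
    (fun m m' => AddMonoidHom.ext (add_tmul R m m'))

@[simp] theorem mk_apply (m : M) (n : N) : mk R m n = tmul R m n := rfl

variable {R}

/-- The universal property of `M ⊗_R N` with respect to balanced biadditive maps. -/
noncomputable def lift (f : M →+ N →+ P) (hf : ∀ (r : R) m n, f (op r • m) n = f m (r • n)) :
    BTensor R M N →+ P :=
  QuotientAddGroup.lift (balancer R M N)
    (TensorProduct.liftAddHom f fun z m n => by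
      simp only [map_zsmul, AddMonoidHom.smul_apply]) (by
    rw [balancer, AddSubgroup.closure_le]
    rintro _ ⟨r, m, n, rfl⟩
    simp [hf])

@[simp] theorem lift_tmul (f : M →+ N →+ P) (hf : ∀ (r : R) m n, f (op r • m) n = f m (r • n))
    (m : M) (n : N) : lift f hf (tmul R m n) = f m n := rfl

@[elab_as_elim]
theorem induction_on {p : BTensor R M N → Prop} (x : BTensor R M N)
    (tmul : ∀ m n, p (tmul R m n)) (add : ∀ x y, p x → p y → p (x + y)) : p x := by
  obtain ⟨t, rfl⟩ := proj_surjective R x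
  induction t using TensorProduct.induction_on with
  | zero => simpa [BTensor.tmul] using tmul 0 0
  | tmul m n => exact tmul m n
  | add a b ha hb => rw [map_add]; exact add _ _ ha hb

theorem hom_ext {f g : BTensor R M N →+ P} (h : ∀ m n, f (tmul R m n) = g (tmul R m n)) : f = g :=
  AddMonoidHom.ext fun x => induction_on x h fun x y hx hy => by rw [map_add, map_add, hx, hy]

end Basic

section Map

variable {R : Type u} {M M' N N' : Type u} [Ring R]
  [AddCommGroup M] [Module Rᵐᵒᵖ M] [AddCommGroup M'] [Module Rᵐᵒᵖ M']
  [AddCommGroup N] [Module R N] [AddCommGroup N'] [Module R N']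

/-- The additive map `f ⊗ g : M ⊗_R N → M' ⊗_R N'`. -/
noncomputable def map (f : M →ₗ[Rᵐᵒᵖ] M') (g : N →ₗ[R] N') : BTensor R M N →+ BTensor R M' N' :=
  lift (((AddMonoidHom.compl₂ (mk R) g.toAddMonoidHom)).comp f.toAddMonoidHom) fun r m n => by
    simp [smul_tmul]

@[simp] theorem map_tmul (f : M →ₗ[Rᵐᵒᵖ] M') (g : N →ₗ[R] N') (m : M) (n : N) :
    map f g (tmul R m n) = tmul R (f m) (g n) := rfl

end Map

section LeftModule

variable {R : Type u} {M N : Type u} [Ring R]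
  [AddCommGroup M] [Module R M] [Module Rᵐᵒᵖ M] [SMulCommClass R Rᵐᵒᵖ M]
  [AddCommGroup N] [Module R N]

/-- If `M` is an `R`-bimodule, then `M ⊗_R N` is a left `R`-module through `M`:
`r (m ⊗ n) = r m ⊗ n`. -/
noncomputable instance instModuleLeft : Module R (BTensor R M N) where
  smul r := map
    ({ toFun := fun m => r • m
       map_add' := smul_add r
       map_smul' := fun s m => smul_comm r s m } : M →ₗ[Rᵐᵒᵖ] M) LinearMap.id
  one_smul x := by
    change map _ _ x = x
    induction x using induction_on with
    | tmul m n => simp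
    | add x y hx hy => rw [map_add, hx, hy]
  mul_smul r s x := by
    change map _ _ x = map _ _ (map _ _ x)
    induction x using induction_on with
    | tmul m n => simp [mul_smul]
    | add x y hx hy => simp only [map_add, hx, hy]
  smul_zero r := map_zero _
  smul_add r := map_add _
  add_smul r s x := by
    change map _ _ x = map _ _ x + map _ _ x
    induction x using induction_on with
    | tmul m n => simp [add_smul, add_tmul]
    | add x y hx hy => simp only [map_add, hx, hy]; abel
  zero_smul x := by
    change map _ _ x = 0
    induction x using induction_on with
    | tmul m n => simp [zero_tmul]
    | add x y hx hy => simp only [map_add, hx, hy, add_zero]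

@[simp] theorem left_smul_tmul (r : R) (m : M) (n : N) :
    r • tmul R m n = tmul R (r • m) n := rfl

end LeftModule

section RightModule

variable {R : Type u} {M N : Type u} [Ring R]
  [AddCommGroup M] [Module Rᵐᵒᵖ M]
  [AddCommGroup N] [Module R N] [Module Rᵐᵒᵖ N] [SMulCommClass R Rᵐᵒᵖ N]

/-- If `N` is an `R`-bimodule, then `M ⊗_R N` is a right `R`-module through `N`:
`(m ⊗ n) r = m ⊗ n r`. -/
noncomputable instance instModuleRight : Module Rᵐᵒᵖ (BTensor R M N) where
  smul r := map LinearMap.id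
    ({ toFun := fun n => r • n
       map_add' := smul_add r
       map_smul' := fun s n => (smul_comm s r n).symm } : N →ₗ[R] N)
  one_smul x := by
    change map _ _ x = x
    induction x using induction_on with
    | tmul m n => simp
    | add x y hx hy => rw [map_add, hx, hy]
  mul_smul r s x := by
    change map _ _ x = map _ _ (map _ _ x)
    induction x using induction_on with
    | tmul m n => simp [mul_smul]
    | add x y hx hy => simp only [map_add, hx, hy]
  smul_zero r := map_zero _
  smul_add r := map_add _
  add_smul r s x := by
    change map _ _ x = map _ _ x + map _ _ x
    induction x using induction_on with
    | tmul m n => simp [add_smul, tmul_add]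
    | add x y hx hy => simp only [map_add, hx, hy]; abel
  zero_smul x := by
    change map _ _ x = 0
    induction x using induction_on with
    | tmul m n => simp [tmul_zero]
    | add x y hx hy => simp only [map_add, hx, hy, add_zero]

@[simp] theorem right_smul_tmul (r : Rᵐᵒᵖ) (m : M) (n : N) :
    r • tmul R m n = tmul R m (r • n) := rfl

end RightModule

section Canonical

/-- If `M` and `N` are `R`-bimodules, so is `M ⊗_R N`. -/
instance instSMulCommClass {R : Type u} {M N : Type u} [Ring R]
    [AddCommGroup M] [Module R M] [Module Rᵐᵒᵖ M] [SMulCommClass R Rᵐᵒᵖ M]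
    [AddCommGroup N] [Module R N] [Module Rᵐᵒᵖ N] [SMulCommClass R Rᵐᵒᵖ N] :
    SMulCommClass R Rᵐᵒᵖ (BTensor R M N) where
  smul_comm r s x := by
    induction x using induction_on with
    | tmul m n => simp
    | add x y hx hy => simp only [smul_add, hx, hy]

variable (R : Type u) (M N P : Type u) [Ring R]

/-- The canonical map `R ⊗_R N → N`, `r ⊗ n ↦ r n`. -/
noncomputable def lid [AddCommGroup N] [Module R N] : BTensor R R N →+ N :=
  lift (AddMonoidHom.mk' (fun r => AddMonoidHom.mk' (fun n : N => r • n) (smul_add r))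
    fun r s => AddMonoidHom.ext fun n => add_smul r s n) fun r s n => by simp [mul_smul]

/-- The canonical map `M ⊗_R R → M`, `m ⊗ r ↦ m r`. -/
noncomputable def rid [AddCommGroup M] [Module Rᵐᵒᵖ M] : BTensor R M R →+ M :=
  lift (AddMonoidHom.mk' (fun m => AddMonoidHom.mk' (fun r : R => op r • m)
      fun r s => by rw [op_add, add_smul])
    fun m m' => AddMonoidHom.ext fun r => smul_add (op r) m m') fun r m s => by
      simp [mul_smul]

/-- The canonical map `(M ⊗_R N) ⊗_R P → M ⊗_R (N ⊗_R P)`, `(m ⊗ n) ⊗ p ↦ m ⊗ (n ⊗ p)`. -/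
noncomputable def assoc [AddCommGroup M] [Module Rᵐᵒᵖ M]
    [AddCommGroup N] [Module R N] [Module Rᵐᵒᵖ N] [SMulCommClass R Rᵐᵒᵖ N]
    [AddCommGroup P] [Module R P] :
    BTensor R (BTensor R M N) P →+ BTensor R M (BTensor R N P) :=
  lift (lift
      (AddMonoidHom.mk' (fun m => AddMonoidHom.mk'
          (fun n => (mk R (M := M) (N := BTensor R N P) m).comp (mk R (M := N) (N := P) n))
          (fun n n' => by rw [map_add, AddMonoidHom.comp_add]))
        (fun m m' => by
          ext n p
          exact add_tmul R m m' (tmul R n p)))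
      (fun r m n => by
        ext p
        exact smul_tmul R r m (tmul R n p)))
    (fun r x p => by
      induction x using induction_on with
      | tmul m n => exact congrArg (tmul R m) (smul_tmul R r n p)
      | add x y hx hy => simp only [smul_add, map_add, AddMonoidHom.add_apply, hx, hy])

@[simp] theorem lid_tmul [AddCommGroup N] [Module R N] (r : R) (n : N) :
    lid R N (tmul R r n) = r • n := rfl

@[simp] theorem rid_tmul [AddCommGroup M] [Module Rᵐᵒᵖ M] (m : M) (r : R) :
    rid R M (tmul R m r) = op r • m := rfl

@[simp] theorem assoc_tmul [AddCommGroup M] [Module Rᵐᵒᵖ M]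
    [AddCommGroup N] [Module R N] [Module Rᵐᵒᵖ N] [SMulCommClass R Rᵐᵒᵖ N]
    [AddCommGroup P] [Module R P] (m : M) (n : N) (p : P) :
    assoc R M N P (tmul R (tmul R m n) p) = tmul R m (tmul R n p) := rfl

end Canonical

end BTensor

/-! ### Corings and comodules -/

section Coring

/-- A homomorphism of `R`-bimodules: a left `R`-linear map that is also right `R`-linear. -/
structure BimoduleHom (R M N : Type u) [Ring R]
    [AddCommGroup M] [Module R M] [Module Rᵐᵒᵖ M]
    [AddCommGroup N] [Module R N] [Module Rᵐᵒᵖ N] extends M →ₗ[R] N where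
  map_op_smul' : ∀ (r : Rᵐᵒᵖ) (m : M), toFun (r • m) = r • toFun m

/-- The right `R`-linear map underlying a homomorphism of bimodules. -/
def BimoduleHom.toRightLinearMap {R M N : Type u} [Ring R]
    [AddCommGroup M] [Module R M] [Module Rᵐᵒᵖ M]
    [AddCommGroup N] [Module R N] [Module Rᵐᵒᵖ N] (f : BimoduleHom R M N) : M →ₗ[Rᵐᵒᵖ] N where
  toFun := f.toFun
  map_add' := f.map_add'
  map_smul' := f.map_op_smul'

/-- An `R`-coring structure on the `R`-bimodule `C`: coassociative and counital bimodule maps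
`Δ : C → C ⊗_R C` and `ε : C → R`. -/
class Coring (R C : Type u) [Ring R]
    [AddCommGroup C] [Module R C] [Module Rᵐᵒᵖ C] [SMulCommClass R Rᵐᵒᵖ C] where
  /-- the comultiplication `Δ` -/
  comul : BimoduleHom R C (BTensor R C C)
  /-- the counit `ε` -/
  counit : BimoduleHom R C R
  /-- `(Δ ⊗ C) ∘ Δ = (C ⊗ Δ) ∘ Δ` -/
  coassoc : ∀ c : C,
    BTensor.assoc R C C C
        (BTensor.map comul.toRightLinearMap LinearMap.id (comul.toLinearMap c)) =
      BTensor.map LinearMap.id comul.toLinearMap (comul.toLinearMap c)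
  /-- `(ε ⊗ C) ∘ Δ = C` -/
  counit_left : ∀ c : C,
    BTensor.lid R C (BTensor.map counit.toRightLinearMap LinearMap.id (comul.toLinearMap c)) = c
  /-- `(C ⊗ ε) ∘ Δ = C` -/
  counit_right : ∀ c : C,
    BTensor.rid R C (BTensor.map LinearMap.id counit.toLinearMap (comul.toLinearMap c)) = c

variable (R C : Type u) [Ring R]
  [AddCommGroup C] [Module R C] [Module Rᵐᵒᵖ C] [SMulCommClass R Rᵐᵒᵖ C] [Coring R C]

/-- A left `C`-comodule structure on the left `R`-module `M`: a coassociative and counital left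
`R`-linear map `M → C ⊗_R M`. -/
class LeftComodule (M : Type u) [AddCommGroup M] [Module R M] where
  /-- the coaction `M → C ⊗_R M` -/
  coact : M →ₗ[R] BTensor R C M
  coassoc : ∀ m : M,
    BTensor.assoc R C C M
        (BTensor.map (Coring.comul (R := R) (C := C)).toRightLinearMap LinearMap.id (coact m)) =
      BTensor.map LinearMap.id coact (coact m)
  counit : ∀ m : M,
    BTensor.lid R M
      (BTensor.map (Coring.counit (R := R) (C := C)).toRightLinearMap LinearMap.id (coact m)) = m

/-- A right `C`-comodule structure on the right `R`-module `M`: a coassociative and counital right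
`R`-linear map `M → M ⊗_R C`. -/
class RightComodule (M : Type u) [AddCommGroup M] [Module Rᵐᵒᵖ M] where
  /-- the coaction `M → M ⊗_R C` -/
  coact : M →ₗ[Rᵐᵒᵖ] BTensor R M C
  coassoc : ∀ m : M,
    BTensor.assoc R M C C (BTensor.map coact LinearMap.id (coact m)) =
      BTensor.map LinearMap.id (Coring.comul (R := R) (C := C)).toLinearMap (coact m)
  counit : ∀ m : M,
    BTensor.rid R M
      (BTensor.map LinearMap.id (Coring.counit (R := R) (C := C)).toLinearMap (coact m)) = m

variable {R}

/-- Left `C`-colinear maps, the morphisms of left `C`-comodules. -/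
def LeftColinear {M N : Type u} [AddCommGroup M] [Module R M] [LeftComodule R C M]
    [AddCommGroup N] [Module R N] [LeftComodule R C N] (f : M →ₗ[R] N) : Prop :=
  ∀ m : M, LeftComodule.coact (R := R) (C := C) (f m) =
    BTensor.map LinearMap.id f (LeftComodule.coact (R := R) (C := C) m)

/-- Right `C`-colinear maps, the morphisms of right `C`-comodules. -/
def RightColinear {M N : Type u} [AddCommGroup M] [Module Rᵐᵒᵖ M] [RightComodule R C M]
    [AddCommGroup N] [Module Rᵐᵒᵖ N] [RightComodule R C N] (f : M →ₗ[Rᵐᵒᵖ] N) : Prop :=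
  ∀ m : M, RightComodule.coact (R := R) (C := C) (f m) =
    BTensor.map f LinearMap.id (RightComodule.coact (R := R) (C := C) m)

/-- `N` is a subcomodule of the left comodule `M`: it carries a comodule structure for which the
inclusion is colinear. -/
def IsLeftSubcomodule {M : Type u} [AddCommGroup M] [Module R M] [LeftComodule R C M]
    (N : Submodule R M) : Prop :=
  ∃ _ : LeftComodule R C N, LeftColinear C N.subtype

/-- `N` is a subcomodule of the right comodule `M`: it carries a comodule structure for which the
inclusion is colinear. -/
def IsRightSubcomodule {M : Type u} [AddCommGroup M] [Module Rᵐᵒᵖ M] [RightComodule R C M]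
    (N : Submodule Rᵐᵒᵖ M) : Prop :=
  ∃ _ : RightComodule R C N, RightColinear C N.subtype

/-! ### Maximal subcomodules, the radical and small subcomodules of left comodules -/

section Left

variable {M : Type u} [AddCommGroup M] [Module R M] [LeftComodule R C M]

/-- A maximal subcomodule: a maximal element among the proper subcomodules. -/
def IsMaximalLeftSubcomodule (N : Submodule R M) : Prop :=
  Maximal (fun L : Submodule R M => IsLeftSubcomodule C L ∧ L ≠ ⊤) N

/-- `K` is a small (superfluous) subcomodule of the left comodule `M`. -/
def IsSmallLeftSubcomodule (K : Submodule R M) : Prop :=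
  IsLeftSubcomodule C K ∧ ∀ L : Submodule R M, IsLeftSubcomodule C L → K ⊔ L = ⊤ → L = ⊤

variable (R M) in
/-- The Jacobson radical `J(M)`: the intersection of all maximal subcomodules (which is `M` if
there is none). -/
def leftComoduleRadical : Submodule R M :=
  sInf {N : Submodule R M | IsMaximalLeftSubcomodule C N}

end Left

/-! ### Right semiperfect corings -/

/-- `K` is a small (superfluous) subcomodule of the right comodule `M`. -/
def IsSmallRightSubcomodule {M : Type u} [AddCommGroup M] [Module Rᵐᵒᵖ M] [RightComodule R C M]
    (K : Submodule Rᵐᵒᵖ M) : Prop :=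
  IsRightSubcomodule C K ∧ ∀ L : Submodule Rᵐᵒᵖ M, IsRightSubcomodule C L → K ⊔ L = ⊤ → L = ⊤

variable (R)

/-- A simple right comodule: it is nonzero and has no subcomodules besides `0` and itself. -/
def IsSimpleRightComodule (S : Type u) [AddCommGroup S] [Module Rᵐᵒᵖ S]
    [RightComodule R C S] : Prop :=
  Nontrivial S ∧ ∀ N : Submodule Rᵐᵒᵖ S, IsRightSubcomodule C N → N = ⊥ ∨ N = ⊤

/-- Projective objects of the category of right `C`-comodules. The epimorphisms of this category
are the surjective colinear maps, because the cokernel of a colinear map in right `R`-modules is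
again a comodule. -/
def IsProjectiveRightComodule (P : Type u) [AddCommGroup P] [Module Rᵐᵒᵖ P]
    [RightComodule R C P] : Prop :=
  ∀ (X Y : Type u) [AddCommGroup X] [Module Rᵐᵒᵖ X] [RightComodule R C X]
    [AddCommGroup Y] [Module Rᵐᵒᵖ Y] [RightComodule R C Y]
    (g : X →ₗ[Rᵐᵒᵖ] Y) (f : P →ₗ[Rᵐᵒᵖ] Y), RightColinear C g → Function.Surjective g →
    RightColinear C f → ∃ h : P →ₗ[Rᵐᵒᵖ] X, RightColinear C h ∧ g ∘ₗ h = f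

/-- The right comodule `S` has a projective cover: a projective comodule `P` and a surjective
colinear map `P → S` with small kernel. -/
def HasProjectiveCover (S : Type u) [AddCommGroup S] [Module Rᵐᵒᵖ S]
    [RightComodule R C S] : Prop :=
  ∃ (P : Type u) (_ : AddCommGroup P) (_ : Module Rᵐᵒᵖ P) (_ : RightComodule R C P)
    (f : P →ₗ[Rᵐᵒᵖ] S), IsProjectiveRightComodule R C P ∧ RightColinear C f ∧
    Function.Surjective f ∧ IsSmallRightSubcomodule C (LinearMap.ker f)

/-- The left `α`-condition: for every right `R`-module `N` the map
`N ⊗_R C → Hom_R(*C, N)`, `n ⊗ c ↦ (f ↦ n f(c))`, is injective, with `*C` the left `R`-linear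
maps `C → R`. -/
def LeftAlphaCondition : Prop :=
  ∀ (N : Type u) [AddCommGroup N] [Module Rᵐᵒᵖ N] (x : BTensor R N C),
    (∀ f : C →ₗ[R] R, BTensor.rid R N (BTensor.map LinearMap.id f x) = 0) → x = 0

/-- `C` is right semiperfect: it satisfies the left `α`-condition and every simple object of the
category of right `C`-comodules has a projective cover. -/
def IsRightSemiperfect : Prop :=
  LeftAlphaCondition R C ∧
    ∀ (S : Type u) [AddCommGroup S] [Module Rᵐᵒᵖ S] [RightComodule R C S],
      IsSimpleRightComodule R C S → HasProjectiveCover R C S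

end Coring

/-- Quasi-Frobenius rings: right artinian and injective as a right module over itself. -/
def IsQFRing (R : Type u) [Ring R] : Prop :=
  IsArtinian Rᵐᵒᵖ R ∧ Module.Injective Rᵐᵒᵖ R

end CoringTheory

/-! The idea is to map a nonzero left comodule `M` to a noetherian left `R`-module by a nonzero
`R`-linear map whose kernel is a subcomodule. A subcomodule over the kernel with maximal image is
then a maximal subcomodule of `M`.

Such a map comes from a projective cover. A nonzero `m : M` lies in a finitely generated subcomodule
`L`. Its dual `Hom_R(L, R)` is a right comodule, because `Hom_R(L, R) ⊗_R C ≃ Hom_R(L, C)`. It is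
artinian and nonzero, so it contains a simple subcomodule `T`, which has a projective cover `P`.
Smallness of the kernel makes `P` finitely generated. The composite `P → T → Hom_R(L, R)` is the
same as a pairing `L → Hom_R(P, R)` compatible with the coactions
(`rightColinear_iff_isColinearPairing`). Pairings extend from `L'` to a finitely generated `L ⊇ L'`:
restriction `Hom_R(L, R) → Hom_R(L', R)` is onto, and `P` is projective
(`IsColinearPairing.exists_extension`). Zorn's lemma yields `Ψ : M → Hom_R(P, R)`, and the target is
noetherian.

On the ring side this needs `R` to be left noetherian, left self-injective and a left cogenerator,
although the definition speaks of the right side only. These facts follow from the double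
annihilator property for left and for right ideals. The latter rests on every simple right module
embedding in `R` (`exists_mul_coatom_eq_zero`).

Smallness of the radical follows by applying the existence statement to the quotient `M ⧸ L`. -/

namespace CoringTheory

/-! ### Quasi-Frobenius rings are left noetherian and left self-injective -/

section QuasiFrobenius

variable {R : Type u} [Ring R]

/-- The right annihilator of a subset of `R`, as a right ideal. -/
def rightAnn (S : Set R) : Submodule Rᵐᵒᵖ R where
  carrier := {s | ∀ a ∈ S, a * s = 0}
  add_mem' hx hy a ha := by rw [mul_add, hx a ha, hy a ha, add_zero]
  zero_mem' a _ := mul_zero a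
  smul_mem' r x hx a ha := by
    rw [← op_unop r, op_smul_eq_mul, ← mul_assoc, hx a ha, zero_mul]

theorem mul_mem_right {J : Submodule Rᵐᵒᵖ R} {x : R} (hx : x ∈ J) (r : R) : x * r ∈ J :=
  J.smul_mem (op r) hx

/-- With `Φ s = (a s)` for `a ∈ F`, the hypothesis says that `s ↦ b s` factors through the image of
`Φ` in `R^F`. Injectivity extends the factor to `k : R^F → R`, and then `b = k (Φ 1)` is the sum of
the `k(e_a) a`. -/
theorem mem_span_of_rightAnn_le (hinj : Module.Injective Rᵐᵒᵖ R) (F : Finset R) (b : R)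
    (h : ∀ s, s ∈ rightAnn (F : Set R) → b * s = 0) : b ∈ Ideal.span (F : Set R) := by
  classical
  let Φ : R →ₗ[Rᵐᵒᵖ] (F → R) := LinearMap.pi fun i => DistribSMul.toLinearMap Rᵐᵒᵖ R (i : R)
  let g : R →ₗ[Rᵐᵒᵖ] R := DistribSMul.toLinearMap Rᵐᵒᵖ R b
  have hker : LinearMap.ker Φ ≤ LinearMap.ker g := fun s hs => by
    refine h s fun a ha => ?_
    exact congrFun (LinearMap.mem_ker.1 hs) ⟨a, ha⟩
  obtain ⟨k, hk⟩ := hinj.out ((LinearMap.ker Φ).liftQ Φ le_rfl)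
    (LinearMap.ker_eq_bot.1 (Submodule.ker_liftQ_eq_bot _ _ _ le_rfl))
    ((LinearMap.ker Φ).liftQ g hker)
  have h1 : b = k (Φ 1) := by
    have := hk ((LinearMap.ker Φ).mkQ 1)
    simp only [Submodule.mkQ_apply, Submodule.liftQ_apply] at this
    rw [this]
    exact (mul_one b).symm
  have h2 : Φ 1 = ∑ i : F, op (i : R) • (Pi.single i (1 : R) : F → R) := by
    ext j
    rw [Finset.sum_apply, Finset.sum_eq_single j]
    · simp [Φ]
    · intro i _ hi
      simp [Pi.single_eq_of_ne (Ne.symm hi)]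
    · simp
  rw [h1, h2, map_sum]
  refine Ideal.sum_mem _ fun i _ => ?_
  rw [map_smul, op_smul_eq_mul]
  exact Ideal.mul_mem_left _ _ (Ideal.subset_span i.2)

variable (hR : IsQFRing R)

-- By the artinian condition some finite `F ⊆ I` has minimal right annihilator, and adjoining a
-- further `b ∈ I` cannot shrink it.
include hR in
theorem exists_finset_rightAnn (I : Ideal R) : ∃ F : Finset R, (F : Set R) ⊆ I ∧
    ∀ b ∈ I, ∀ s ∈ rightAnn (F : Set R), b * s = 0 := by
  classical
  have := hR.1
  obtain ⟨_, ⟨F, hF, rfl⟩, hmin⟩ := IsArtinian.set_has_minimal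
    {J : Submodule Rᵐᵒᵖ R | ∃ F : Finset R, (F : Set R) ⊆ I ∧ J = rightAnn (F : Set R)}
    ⟨_, ∅, by simp, rfl⟩
  refine ⟨F, hF, fun b hb s hs => ?_⟩
  by_contra hbs
  refine hmin _ ⟨insert b F, ?_, rfl⟩ (lt_of_le_of_ne (fun t ht a ha => ht a ?_) fun heq => ?_)
  · rw [Finset.coe_insert]
    exact Set.insert_subset hb hF
  · exact Finset.mem_insert_of_mem ha
  · rw [← heq] at hs
    exact hbs (hs b (Finset.mem_insert_self b F))

include hR in
/-- A quasi-Frobenius ring is left noetherian. -/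
theorem IsQFRing.isNoetherian : IsNoetherian R R :=
  ⟨fun I => by
    obtain ⟨F, hF, h⟩ := exists_finset_rightAnn hR I
    refine ⟨F, le_antisymm (Submodule.span_le.2 hF) fun b hb => ?_⟩
    exact mem_span_of_rightAnn_le hR.2 F b (h b hb)⟩

include hR in
/-- Every left ideal of a quasi-Frobenius ring is a left annihilator. -/
theorem mem_of_rightAnn_le (I : Ideal R) (b : R)
    (h : ∀ s ∈ rightAnn (I : Set R), b * s = 0) : b ∈ I := by
  obtain ⟨F, hF, h'⟩ := exists_finset_rightAnn hR I
  exact Ideal.span_le.2 hF (mem_span_of_rightAnn_le hR.2 F b fun s hs => h s fun a ha => h' a ha s hs)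

include hR in
theorem exists_mul_eq_of_rightAnn_le (a b : R) (h : ∀ s, a * s = 0 → b * s = 0) :
    ∃ c, b = c * a := by
  have := mem_span_of_rightAnn_le hR.2 {a} b fun s hs => h s (hs a (by simp))
  rw [Finset.coe_singleton, Ideal.mem_span_singleton'] at this
  obtain ⟨c, hc⟩ := this
  exact ⟨c, hc.symm⟩

/-! ### Isomorphism classes of simple right modules -/

/-- The maximal right ideals `J` and `J'` have isomorphic quotients `R ⧸ J ≃ R ⧸ J'`. -/
def QuotEquiv (J J' : Submodule Rᵐᵒᵖ R) : Prop := ∃ w ∉ J', ∀ s ∈ J, w * s ∈ J'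

theorem one_notMem {J : Submodule Rᵐᵒᵖ R} (hJ : J ≠ ⊤) : (1 : R) ∉ J := fun h =>
  hJ (eq_top_iff.2 fun r _ => by simpa using mul_mem_right h r)

theorem eq_top_of_one_mem {J : Submodule Rᵐᵒᵖ R} (h : (1 : R) ∈ J) : J = ⊤ := by
  by_contra hJ
  exact one_notMem hJ h

theorem exists_one_sub_mul_mem {J : Submodule Rᵐᵒᵖ R} (hJ : IsCoatom J) {w : R} (hw : w ∉ J) :
    ∃ v, 1 - w * v ∈ J := by
  have h : J ⊔ Submodule.span Rᵐᵒᵖ {w} = ⊤ := hJ.2 _ (lt_of_le_of_ne le_sup_left fun h => hw (by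
    rw [h]
    exact Submodule.mem_sup_right (Submodule.mem_span_singleton_self w)))
  have h1 : (1 : R) ∈ J ⊔ Submodule.span Rᵐᵒᵖ {w} := h ▸ Submodule.mem_top
  obtain ⟨j, hj, _, hy, hjy⟩ := Submodule.mem_sup.1 h1
  obtain ⟨v, rfl⟩ := Submodule.mem_span_singleton.1 hy
  refine ⟨unop v, ?_⟩
  rw [← hjy, ← op_smul_eq_mul, op_unop, add_sub_cancel_right]
  exact hj

theorem QuotEquiv.refl {J : Submodule Rᵐᵒᵖ R} (hJ : J ≠ ⊤) : QuotEquiv J J :=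
  ⟨1, one_notMem hJ, fun s hs => by rwa [one_mul]⟩

/-- The preimage of `J` under left multiplication by `w`. -/
def mulComap (J : Submodule Rᵐᵒᵖ R) (w : R) : Submodule Rᵐᵒᵖ R :=
  J.comap (DistribSMul.toLinearMap Rᵐᵒᵖ R w)

theorem mem_mulComap {J : Submodule Rᵐᵒᵖ R} {w s : R} : s ∈ mulComap J w ↔ w * s ∈ J := Iff.rfl

/-- Schur's lemma: left multiplication by `w` induces a nonzero map `R ⧸ J → R ⧸ J'`, injective
because `R ⧸ J` is simple. -/
theorem QuotEquiv.eq_mulComap {J J' : Submodule Rᵐᵒᵖ R} (hJ : IsCoatom J) {w : R} (hw : w ∉ J')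
    (h : ∀ s ∈ J, w * s ∈ J') : mulComap J' w = J := by
  by_contra hne
  have := hJ.2 (mulComap J' w) (lt_of_le_of_ne h (Ne.symm hne))
  have h1 : (1 : R) ∈ mulComap J' w := this ▸ Submodule.mem_top
  rw [mem_mulComap, mul_one] at h1
  exact hw h1

theorem QuotEquiv.symm {J J' : Submodule Rᵐᵒᵖ R} (hJ : IsCoatom J) (hJ' : IsCoatom J')
    (h : QuotEquiv J J') : QuotEquiv J' J := by
  obtain ⟨w, hw, h⟩ := h
  -- Left multiplication by `v` induces the inverse map, since `w v` is `1` modulo `J'`.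
  obtain ⟨v, hv⟩ := exists_one_sub_mul_mem hJ' hw
  have hc := QuotEquiv.eq_mulComap hJ hw h
  refine ⟨v, fun hvJ => one_notMem hJ'.1 ?_, fun s hs => ?_⟩
  · simpa using J'.add_mem hv (h v hvJ)
  · rw [← hc, mem_mulComap]
    have := J'.sub_mem hs (mul_mem_right hv s)
    rwa [sub_mul, one_mul, sub_sub_cancel, mul_assoc] at this

theorem QuotEquiv.trans {J J' J'' : Submodule Rᵐᵒᵖ R} (hJ' : IsCoatom J')
    (h : QuotEquiv J J') (h' : QuotEquiv J' J'') : QuotEquiv J J'' := by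
  obtain ⟨w, hw, h⟩ := h
  obtain ⟨w', hw', h'⟩ := h'
  refine ⟨w' * w, fun hmem => hw ?_, fun s hs => ?_⟩
  · rw [← QuotEquiv.eq_mulComap hJ' hw' h']
    exact hmem
  · rw [mul_assoc]
    exact h' _ (h s hs)

/-- Multiplication by `w` embeds `R ⧸ mulComap J w` in the simple module `R ⧸ J` with nonzero image.
-/
theorem isCoatom_mulComap {J : Submodule Rᵐᵒᵖ R} (hJ : IsCoatom J) {w : R} (hw : w ∉ J) :
    IsCoatom (mulComap J w) := by
  refine ⟨fun h => hw ?_, fun K hK => ?_⟩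
  · have : (1 : R) ∈ mulComap J w := h ▸ Submodule.mem_top
    rwa [mem_mulComap, mul_one] at this
  · obtain ⟨k, hk, hkJ⟩ := SetLike.exists_of_lt hK
    obtain ⟨v, hv⟩ := exists_one_sub_mul_mem (w := w * k) hJ hkJ
    refine eq_top_of_one_mem ?_
    have h1 : 1 - k * (v * w) ∈ mulComap J w := by
      rw [mem_mulComap, mul_sub, mul_one]
      have := mul_mem_right hv w
      rwa [sub_mul, one_mul, mul_assoc, mul_assoc] at this
    simpa using K.add_mem (hK.le h1) (mul_mem_right hk (v * w))

/-- If a maximal right ideal contains `I ⊓ J'` but not `I`, its quotient is that of `J'`. -/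
theorem quotEquiv_of_inf_le {I J J' : Submodule Rᵐᵒᵖ R} (hJ : IsCoatom J) (hJ' : IsCoatom J')
    (hle : I ⊓ J' ≤ J) (hI : ¬ I ≤ J) : QuotEquiv J J' := by
  obtain ⟨i, hi, hiJ⟩ := SetLike.not_le_iff_exists.1 hI
  -- This says `I ⊓ J = I ⊓ J'`, whence `R ⧸ J ≃ I ⧸ (I ⊓ J) = I ⧸ (I ⊓ J') ≃ R ⧸ J'`. The witness
  -- `i * s` below is an element of `I` congruent to `1` modulo `J`.
  have key : ∀ x ∈ I, x ∈ J → x ∈ J' := fun x hxI hxJ => by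
    by_contra hx
    obtain ⟨t, ht⟩ := exists_one_sub_mul_mem hJ' hx
    have h1 : i - x * (t * i) ∈ I ⊓ J' := by
      refine ⟨I.sub_mem hi (mul_mem_right hxI _), ?_⟩
      have := mul_mem_right ht i
      rwa [sub_mul, one_mul, mul_assoc] at this
    refine hiJ ?_
    simpa using J.add_mem (hle h1) (mul_mem_right hxJ (t * i))
  obtain ⟨s, hs⟩ := exists_one_sub_mul_mem hJ hiJ
  refine ⟨i * s, fun h => ?_, fun j hj => ?_⟩
  · have h2 := hle ⟨mul_mem_right hi s, h⟩
    exact one_notMem hJ.1 (by simpa using J.add_mem hs h2)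
  · refine key _ (mul_mem_right (mul_mem_right hi s) j) ?_
    have := J.sub_mem hj (mul_mem_right hs j)
    rwa [sub_mul, one_mul, sub_sub_cancel] at this

theorem exists_quotEquiv_of_finset_inf_le {ι : Type*} (f : ι → Submodule Rᵐᵒᵖ R) (F : Finset ι)
    (hf : ∀ i ∈ F, IsCoatom (f i)) {J : Submodule Rᵐᵒᵖ R} (hJ : IsCoatom J)
    (h : F.inf f ≤ J) : ∃ i ∈ F, QuotEquiv J (f i) := by
  classical
  induction F using Finset.induction_on with
  | empty => exact absurd (top_le_iff.1 h) hJ.1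
  | insert i F hi ih =>
    by_cases hF : F.inf f ≤ J
    · obtain ⟨k, hk, hk'⟩ := ih (fun k hk => hf k (Finset.mem_insert_of_mem hk)) hF
      exact ⟨k, Finset.mem_insert_of_mem hk, hk'⟩
    · refine ⟨i, Finset.mem_insert_self i F,
        quotEquiv_of_inf_le hJ (hf i (Finset.mem_insert_self i F)) ?_ hF⟩
      rw [Finset.inf_insert, inf_comm] at h
      exact h

theorem exists_finset_inf_le [IsArtinian Rᵐᵒᵖ R] {ι : Type*} (f : ι → Submodule Rᵐᵒᵖ R) :
    ∃ F : Finset ι, ∀ i, F.inf f ≤ f i := by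
  classical
  obtain ⟨_, ⟨F, rfl⟩, hmin⟩ := IsArtinian.set_has_minimal
    (Set.range fun F : Finset ι => F.inf f) ⟨_, ∅, rfl⟩
  refine ⟨F, fun i => ?_⟩
  by_contra h
  refine hmin _ ⟨insert i F, rfl⟩ (lt_of_le_of_ne ?_ fun heq => h ?_)
  · exact Finset.inf_mono (Finset.subset_insert i F)
  · dsimp only at heq
    rw [← heq]
    exact Finset.inf_le (Finset.mem_insert_self i F)

/-- The largest left ideal inside a right ideal: the annihilator of `R ⧸ J`. -/
def core (J : Submodule Rᵐᵒᵖ R) : Ideal R where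
  carrier := {q | ∀ r, r * q ∈ J}
  add_mem' hx hy r := by rw [mul_add]; exact J.add_mem (hx r) (hy r)
  zero_mem' r := by rw [mul_zero]; exact J.zero_mem
  smul_mem' c x hx r := by rw [smul_eq_mul, ← mul_assoc]; exact hx _

theorem mem_core {J : Submodule Rᵐᵒᵖ R} {q : R} : q ∈ core J ↔ ∀ r, r * q ∈ J := Iff.rfl

theorem core_mul_mem {J : Submodule Rᵐᵒᵖ R} {q : R} (hq : q ∈ core J) (c : R) :
    q * c ∈ core J := fun r => by
  rw [← mul_assoc]
  exact mul_mem_right (hq r) c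

/-- By the artinian condition `core J` is an intersection of finitely many annihilators `mulComap J
r` of nonzero elements of `R ⧸ J`. Each of them has quotient isomorphic to `R ⧸ J`. -/
theorem quotEquiv_of_core_le [IsArtinian Rᵐᵒᵖ R] {J J' : Submodule Rᵐᵒᵖ R} (hJ : IsCoatom J)
    (hJ' : IsCoatom J') (h : ∀ q ∈ core J, q ∈ J') : QuotEquiv J' J := by
  obtain ⟨F, hF⟩ := exists_finset_inf_le fun r : {r : R // r ∉ J} => mulComap J r
  obtain ⟨r, -, hr⟩ := exists_quotEquiv_of_finset_inf_le _ F
    (fun r _ => isCoatom_mulComap hJ r.2) hJ' fun q hq => h q fun r => by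
      by_cases hr : r ∈ J
      · exact mul_mem_right hr q
      · exact hF ⟨r, hr⟩ hq
  exact hr.trans (isCoatom_mulComap hJ r.2) ⟨r, r.2, fun s hs => hs⟩

/-! ### The Kasch property -/

include hR in
-- As a proper left ideal, `core J` has nonzero right annihilator by `mem_of_rightAnn_le`. This
-- annihilator contains a minimal right ideal `x R ≃ R ⧸ rightAnn {x}`.
theorem exists_core_mul_eq_zero {J : Submodule Rᵐᵒᵖ R} (hJ : IsCoatom J) :
    ∃ x : R, (∀ q ∈ core J, q * x = 0) ∧ IsCoatom (rightAnn {x}) := by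
  have := hR.1
  have hne : rightAnn (core J : Set R) ≠ ⊥ := fun h => by
    have : (1 : R) ∈ core J := mem_of_rightAnn_le hR _ _ fun s hs => by
      rw [h, Submodule.mem_bot] at hs
      rw [hs, mul_zero]
    exact one_notMem hJ.1 (by simpa using mem_core.1 this 1)
  obtain ⟨A, ⟨hA, hA0⟩, hmin⟩ := IsArtinian.set_has_minimal
    {A : Submodule Rᵐᵒᵖ R | A ≤ rightAnn (core J : Set R) ∧ A ≠ ⊥} ⟨_, le_rfl, hne⟩
  obtain ⟨x, hx, hx0⟩ := Submodule.exists_mem_ne_zero_of_ne_bot hA0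
  refine ⟨x, fun q hq => hA hx q hq, fun h => hx0 ?_, fun K hK => ?_⟩
  · have h1 : (1 : R) ∈ rightAnn {x} := h ▸ Submodule.mem_top
    simpa using h1 x rfl
  · obtain ⟨k, hk, hkx⟩ := SetLike.exists_of_lt hK
    have hxk : x * k ≠ 0 := fun h => hkx fun a ha => by rwa [Set.mem_singleton_iff.1 ha]
    have hle : Submodule.span Rᵐᵒᵖ {x * k} ≤ A := by
      rw [Submodule.span_singleton_le_iff_mem]
      exact mul_mem_right hx k
    have heq : Submodule.span Rᵐᵒᵖ {x * k} = A := by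
      by_contra hne
      refine hmin _ ⟨hle.trans hA, fun h => hxk ?_⟩ (lt_of_le_of_ne hle hne)
      exact Submodule.span_singleton_eq_bot.1 h
    rw [← heq] at hx
    obtain ⟨t, ht⟩ := Submodule.mem_span_singleton.1 hx
    have h1 : 1 - k * unop t ∈ rightAnn {x} := fun a ha => by
      rw [Set.mem_singleton_iff.1 ha, mul_sub, mul_one, ← mul_assoc, ← op_smul_eq_mul, op_unop, ht,
        sub_self]
    exact eq_top_of_one_mem (by simpa using K.add_mem (hK.le h1) (mul_mem_right hk (unop t)))

-- If `R ⧸ J₁` and `R ⧸ J₂` were not isomorphic, the two cores would be comaximal, because a maximal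
-- right ideal above both would have quotient isomorphic to each. But `x₂ w = c x₁` is killed on the
-- left by both cores, as these are two-sided ideals, so it would be zero.
include hR in
theorem quotEquiv_of_rightAnn {J₁ J₂ : Submodule Rᵐᵒᵖ R} (h₁ : IsCoatom J₁) (h₂ : IsCoatom J₂)
    {x₁ x₂ : R} (hx₁ : ∀ q ∈ core J₁, q * x₁ = 0) (hx₂ : ∀ q ∈ core J₂, q * x₂ = 0)
    (h : QuotEquiv (rightAnn {x₁}) (rightAnn {x₂})) : QuotEquiv J₁ J₂ := by
  have := hR.1
  obtain ⟨w, hw, h⟩ := h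
  obtain ⟨c, hc⟩ := exists_mul_eq_of_rightAnn_le hR x₁ (x₂ * w) fun s hs => by
    rw [mul_assoc]
    exact h s (fun a ha => by rwa [Set.mem_singleton_iff.1 ha]) _ rfl
  by_contra hne
  let K : Submodule Rᵐᵒᵖ R :=
    { carrier := {k | ∃ q₁ ∈ core J₁, ∃ q₂ ∈ core J₂, q₁ + q₂ = k}
      add_mem' := by
        rintro _ _ ⟨a, ha, b, hb, rfl⟩ ⟨a', ha', b', hb', rfl⟩
        exact ⟨a + a', add_mem ha ha', b + b', add_mem hb hb', by abel⟩
      zero_mem' := ⟨0, zero_mem _, 0, zero_mem _, add_zero 0⟩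
      smul_mem' := by
        rintro r _ ⟨a, ha, b, hb, rfl⟩
        exact ⟨_, core_mul_mem ha (unop r), _, core_mul_mem hb (unop r), (add_mul _ _ _).symm⟩ }
  have : IsCoatomic (Submodule Rᵐᵒᵖ R) := by
    have : Module.Finite Rᵐᵒᵖ R := ⟨{1}, by
      rw [Finset.coe_singleton]
      exact eq_top_of_one_mem (Submodule.mem_span_singleton_self 1)⟩
    infer_instance
  rcases eq_top_or_exists_le_coatom K with hK | ⟨J₃, h₃, hK⟩
  · have h1 : (1 : R) ∈ K := hK ▸ Submodule.mem_top
    obtain ⟨q₁, hq₁, q₂, hq₂, h12⟩ := h1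
    refine hw fun a ha => ?_
    rw [Set.mem_singleton_iff.1 ha, ← one_mul (x₂ * w), ← h12, add_mul, ← mul_assoc q₂, hx₂ q₂ hq₂,
      zero_mul, add_zero, hc, ← mul_assoc]
    exact hx₁ _ (core_mul_mem hq₁ c)
  · have e₁ := quotEquiv_of_core_le h₁ h₃ fun q hq => hK ⟨q, hq, 0, zero_mem _, add_zero q⟩
    have e₂ := quotEquiv_of_core_le h₂ h₃ fun q hq => hK ⟨0, zero_mem _, q, hq, zero_add q⟩
    exact hne ((e₁.symm h₃ h₁).trans h₃ e₂)

include hR in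
/-- A quasi-Frobenius ring is right Kasch: maximal right ideals are right annihilators. -/
theorem exists_mul_coatom_eq_zero {J : Submodule Rᵐᵒᵖ R} (hJ : IsCoatom J) :
    ∃ x : R, x ≠ 0 ∧ ∀ s ∈ J, x * s = 0 := by
  have := hR.1
  let S : Setoid {J : Submodule Rᵐᵒᵖ R // IsCoatom J} :=
    ⟨fun J J' => QuotEquiv J.1 J'.1, fun J => .refl J.2.1, fun {J J'} h => h.symm J.2 J'.2,
      fun {_ J' _} h h' => h.trans J'.2 h'⟩
  have hfin : Finite (Quotient S) := by
    -- A finite intersection of maximal right ideals lies in all of them, so its members represent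
    -- all classes.
    obtain ⟨F, hF⟩ := exists_finset_inf_le fun J : {J : Submodule Rᵐᵒᵖ R // IsCoatom J} => J.1
    refine Finite.of_surjective (fun J : F => (⟦J.1⟧ : Quotient S)) fun q => ?_
    induction q using Quotient.inductionOn with | h J => ?_
    obtain ⟨J', hJ', h⟩ := exists_quotEquiv_of_finset_inf_le _ F (fun J _ => J.2) J.2 (hF J)
    exact ⟨⟨J', hJ'⟩, (Quotient.sound h).symm⟩
  choose x hx hx' using fun J : {J : Submodule Rᵐᵒᵖ R // IsCoatom J} =>
    exists_core_mul_eq_zero hR J.2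
  -- The class of `R ⧸ J` goes to that of the minimal right ideal `x R` killed by `core J`. This
  -- self-map of a finite set is injective, hence onto, so every simple right module is isomorphic
  -- to some `x R`.
  let ρ : Quotient S → Quotient S := fun q => ⟦⟨rightAnn {x q.out}, hx' _⟩⟧
  have hρ : Function.Injective ρ := fun q q' h => by
    have h' : QuotEquiv (rightAnn {x q.out}) (rightAnn {x q'.out}) := Quotient.exact h
    rw [← q.out_eq, ← q'.out_eq]
    exact Quotient.sound (quotEquiv_of_rightAnn hR q.out.2 q'.out.2 (hx _) (hx _) h')
  obtain ⟨q, hq⟩ := Finite.injective_iff_surjective.1 hρ ⟦⟨J, hJ⟩⟧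
  have h' : QuotEquiv (rightAnn {x q.out}) J := Quotient.exact hq
  obtain ⟨w, hw, h⟩ := h'.symm (hx' _) hJ
  refine ⟨x q.out * w, fun h0 => hw fun a ha => by rwa [Set.mem_singleton_iff.1 ha],
    fun s hs => ?_⟩
  rw [mul_assoc]
  exact h s hs _ rfl

/-! ### Double annihilators and left self-injectivity -/

include hR in
/-- Every right ideal of a quasi-Frobenius ring is a right annihilator. -/
theorem mem_of_leftAnn_le (J : Submodule Rᵐᵒᵖ R) (x : R)
    (h : ∀ c : R, (∀ s ∈ J, c * s = 0) → c * x = 0) : x ∈ J := by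
  have hinj := hR.2
  have : Module.Finite Rᵐᵒᵖ R := ⟨{1}, by
    rw [Finset.coe_singleton]
    exact eq_top_of_one_mem (Submodule.mem_span_singleton_self 1)⟩
  by_contra hx
  have hne : mulComap J x ≠ ⊤ := fun h => hx (by
    have h1 : (1 : R) ∈ mulComap J x := h ▸ Submodule.mem_top
    rwa [mem_mulComap, mul_one] at h1)
  obtain ⟨J', hJ', hle⟩ := (eq_top_or_exists_le_coatom (mulComap J x)).resolve_left hne
  -- The map `x s + J ↦ y s` is well defined on `(x R + J) ⧸ J`, since `J'` contains the annihilator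
  -- of `x + J`. Its extension to `R ⧸ J` is left multiplication by some `c` that kills `J` and has
  -- `c x = y ≠ 0`.
  obtain ⟨y, hy, hyJ⟩ := exists_mul_coatom_eq_zero hR hJ'
  let f : R →ₗ[Rᵐᵒᵖ] R ⧸ J := J.mkQ ∘ₗ DistribSMul.toLinearMap Rᵐᵒᵖ R x
  have hker : ∀ s, f s = 0 ↔ s ∈ mulComap J x := fun s => Submodule.Quotient.mk_eq_zero J
  let g : R →ₗ[Rᵐᵒᵖ] R := DistribSMul.toLinearMap Rᵐᵒᵖ R y
  have hle' : LinearMap.ker f ≤ LinearMap.ker g := fun s hs => hyJ s (hle ((hker s).1 hs))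
  obtain ⟨k, hk⟩ := hinj.out ((LinearMap.ker f).liftQ f le_rfl)
    (LinearMap.ker_eq_bot.1 (Submodule.ker_liftQ_eq_bot _ _ _ le_rfl))
    ((LinearMap.ker f).liftQ g hle')
  have hk1 : ∀ s, k (J.mkQ s) = k (J.mkQ 1) * s := fun s => by
    rw [← op_smul_eq_mul, ← map_smul, ← map_smul, op_smul_eq_mul, one_mul]
  have hx0 := h (k (J.mkQ 1)) fun s hs => by
    rw [← hk1, Submodule.mkQ_apply, (Submodule.Quotient.mk_eq_zero J).2 hs, map_zero]
  have h1 := hk ((LinearMap.ker f).mkQ 1)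
  simp only [Submodule.mkQ_apply, Submodule.liftQ_apply] at h1
  have h2 : f 1 = J.mkQ x := congrArg J.mkQ (mul_one x)
  rw [h2, hk1, hx0] at h1
  exact hy (by simpa [g] using h1.symm)

-- The Ikeda–Nakayama argument. For a cyclic ideal, `f a` is killed by the left annihilator of `a`,
-- hence lies in `a R`. For a sum, the multipliers on `I₁` and `I₂` differ by an element killed by
-- `I₁ ⊓ I₂`. Double annihilators split it into a part killed by `I₁` and a part killed by `I₂`,
-- which correct the multipliers to a common one.
include hR in
theorem exists_eq_mul_of_fg (I : Ideal R) (hI : I.FG) (f : I →ₗ[R] R) :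
    ∃ c, ∀ x : I, f x = x * c := by
  induction I, hI using Submodule.fg_induction with
  | singleton a =>
    have ha : a ∈ Ideal.span {a} := Ideal.mem_span_singleton_self a
    have hmem : f ⟨a, ha⟩ ∈ Submodule.span Rᵐᵒᵖ {a} := mem_of_leftAnn_le hR _ _ fun c hc => by
      have h0 : c • (⟨a, ha⟩ : Ideal.span {a}) = 0 :=
        Subtype.ext (hc a (Submodule.mem_span_singleton_self a))
      rw [← smul_eq_mul, ← map_smul, h0, map_zero]
    obtain ⟨c, hc⟩ := Submodule.mem_span_singleton.1 hmem
    refine ⟨unop c, fun ⟨x, hx⟩ => ?_⟩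
    obtain ⟨r, rfl⟩ := Ideal.mem_span_singleton'.1 hx
    have h1 : (⟨r * a, hx⟩ : Ideal.span {a}) = r • ⟨a, ha⟩ := rfl
    rw [h1, map_smul, ← hc]
    exact (mul_assoc r a (unop c)).symm
  | sup I₁ I₂ _ _ ih₁ ih₂ =>
    obtain ⟨c₁, h₁⟩ := ih₁ (f ∘ₗ Submodule.inclusion le_sup_left)
    obtain ⟨c₂, h₂⟩ := ih₂ (f ∘ₗ Submodule.inclusion le_sup_right)
    have hmem : c₁ - c₂ ∈ rightAnn (I₁ : Set R) ⊔ rightAnn (I₂ : Set R) := by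
      refine mem_of_leftAnn_le hR _ _ fun c hc => ?_
      have m₁ : c ∈ I₁ := mem_of_rightAnn_le hR _ _ fun s hs => hc s (Submodule.mem_sup_left hs)
      have m₂ : c ∈ I₂ := mem_of_rightAnn_le hR _ _ fun s hs => hc s (Submodule.mem_sup_right hs)
      rw [mul_sub, sub_eq_zero]
      exact (h₁ ⟨c, m₁⟩).symm.trans (h₂ ⟨c, m₂⟩)
    obtain ⟨d₁, hd₁, d₂, hd₂, hd⟩ := Submodule.mem_sup.1 hmem
    refine ⟨c₁ - d₁, fun ⟨x, hx⟩ => ?_⟩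
    obtain ⟨x₁, hx₁, x₂, hx₂, rfl⟩ := Submodule.mem_sup.1 hx
    have hsplit : (⟨x₁ + x₂, hx⟩ : ↥(I₁ ⊔ I₂)) = Submodule.inclusion le_sup_left ⟨x₁, hx₁⟩ +
      Submodule.inclusion le_sup_right ⟨x₂, hx₂⟩ := rfl
    have e₁ : f (Submodule.inclusion le_sup_left ⟨x₁, hx₁⟩) = x₁ * c₁ := h₁ ⟨x₁, hx₁⟩
    have e₂ : f (Submodule.inclusion le_sup_right ⟨x₂, hx₂⟩) = x₂ * c₂ := h₂ ⟨x₂, hx₂⟩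
    have hc : c₁ - d₁ = c₂ + d₂ := by
      rw [sub_eq_iff_eq_add, add_assoc, add_comm d₂, hd, add_sub_cancel]
    refine (congrArg f hsplit).trans ?_
    rw [map_add, e₁, e₂]
    refine Eq.trans ?_ (add_mul x₁ x₂ _).symm
    congr 1
    · rw [mul_sub, hd₁ x₁ hx₁, sub_zero]
    · rw [hc, mul_add, hd₂ x₂ hx₂, add_zero]

include hR in
/-- A quasi-Frobenius ring is left self-injective. -/
theorem IsQFRing.injective : Module.Injective R R := by
  have := hR.isNoetherian
  refine Module.Baer.injective fun I f => ?_
  obtain ⟨c, hc⟩ := exists_eq_mul_of_fg hR I (IsNoetherian.noetherian I) f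
  exact ⟨LinearMap.toSpanSingleton R R c, fun x hx => (hc ⟨x, hx⟩).symm⟩

include hR in
/-- A quasi-Frobenius ring is a left cogenerator. -/
theorem IsQFRing.exists_functional_ne_zero {L : Type u} [AddCommGroup L] [Module R L] {l : L}
    (hl : l ≠ 0) : ∃ f : L →ₗ[R] R, f l ≠ 0 := by
  have hinj := hR.injective
  -- The annihilator of `l` is a proper left ideal, so it kills some `s ≠ 0` on its right. Then `r l
  -- ↦ r s` is well defined on `R l`, and it extends by left self-injectivity.
  have hex : ∃ s ∈ rightAnn (LinearMap.ker (LinearMap.toSpanSingleton R L l) : Set R), s ≠ 0 := by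
    by_contra! h
    have h1 : (1 : R) ∈ LinearMap.ker (LinearMap.toSpanSingleton R L l) :=
      mem_of_rightAnn_le hR _ _ fun s hs => by rw [h s hs, mul_zero]
    exact hl (by simpa using h1)
  obtain ⟨s, hs, hs0⟩ := hex
  obtain ⟨k, hk⟩ := Module.Injective.extension_property R R _ _
    ((LinearMap.ker (LinearMap.toSpanSingleton R L l)).liftQ _ le_rfl)
    (LinearMap.ker_eq_bot.1 (Submodule.ker_liftQ_eq_bot _ _ _ le_rfl))
    ((LinearMap.ker (LinearMap.toSpanSingleton R L l)).liftQ (LinearMap.toSpanSingleton R R s)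
      fun r hr => hs r hr)
  refine ⟨k, fun h0 => hs0 ?_⟩
  have h1 : k ((1 : R) • l) = (1 : R) • s := LinearMap.congr_fun hk (Submodule.mkQ _ 1)
  rwa [one_smul, one_smul, h0, eq_comm] at h1

end QuasiFrobenius

/-! ### Dual bases and contractions of tensors -/

section DualBasis

variable {R C : Type u} [Ring R] [AddCommGroup C]

/-- The expansion is required over every larger finite set as well, so that several elements can be
expanded over a common one. -/
theorem exists_dualBasis [Module R C] (h : Module.Projective R C) :
    ∃ f : C → C →ₗ[R] R, ∀ c, ∃ D : Finset C, ∀ D', D ⊆ D' → c = ∑ d ∈ D', f d c • d := by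
  obtain ⟨s, hs⟩ := Module.projective_def'.1 h
  refine ⟨fun d => Finsupp.lapply d ∘ₗ s, fun c => ⟨(s c).support, fun D' hD' => ?_⟩⟩
  have h1 : Finsupp.linearCombination R id (s c) = c := LinearMap.congr_fun hs c
  rw [Finsupp.linearCombination_apply, Finsupp.sum_of_support_subset _ hD' _ (by simp)] at h1
  exact h1.symm

theorem exists_dualBasis_right [Module Rᵐᵒᵖ C] (h : Module.Projective Rᵐᵒᵖ C) :
    ∃ f : C → C →ₗ[Rᵐᵒᵖ] R, ∀ c, ∃ D : Finset C, ∀ D', D ⊆ D' →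
      c = ∑ d ∈ D', op (f d c) • d := by
  obtain ⟨f, hf⟩ := exists_dualBasis h
  refine ⟨fun d =>
    { toFun := fun c => unop (f d c)
      map_add' := fun c c' => by rw [map_add, unop_add]
      map_smul' := fun r c => by rw [map_smul]; rfl }, fun c => ?_⟩
  exact hf c

end DualBasis

namespace BTensor

section Map

variable {R : Type u} {M M' M'' N N' N'' : Type u} [Ring R]
  [AddCommGroup M] [Module Rᵐᵒᵖ M] [AddCommGroup M'] [Module Rᵐᵒᵖ M']
  [AddCommGroup M''] [Module Rᵐᵒᵖ M'']
  [AddCommGroup N] [Module R N] [AddCommGroup N'] [Module R N']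
  [AddCommGroup N''] [Module R N'']

theorem map_map (f : M →ₗ[Rᵐᵒᵖ] M') (g : N →ₗ[R] N') (f' : M' →ₗ[Rᵐᵒᵖ] M'') (g' : N' →ₗ[R] N'')
    (x : BTensor R M N) : map f' g' (map f g x) = map (f' ∘ₗ f) (g' ∘ₗ g) x := by
  induction x using induction_on with
  | tmul m n => rfl
  | add x y hx hy => simp only [map_add, hx, hy]

theorem map_id_id (x : BTensor R M N) : map LinearMap.id LinearMap.id x = x := by
  induction x using induction_on with
  | tmul m n => rfl
  | add x y hx hy => simp only [map_add, hx, hy]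

/-- The map `M ⊗_R g` as a left `R`-linear map, for a bimodule `M`. -/
noncomputable def mapLeftLinear (M : Type u) [AddCommGroup M] [Module R M] [Module Rᵐᵒᵖ M]
    [SMulCommClass R Rᵐᵒᵖ M] (g : N →ₗ[R] N') : BTensor R M N →ₗ[R] BTensor R M N' where
  toFun := map LinearMap.id g
  map_add' := map_add _
  map_smul' r x := by
    induction x using induction_on with
    | tmul m n => rfl
    | add x y hx hy => simp only [smul_add, map_add, hx, hy]

/-- The map `g ⊗_R N` as a right `R`-linear map, for a bimodule `N`. -/
noncomputable def mapRightLinear (N : Type u) [AddCommGroup N] [Module R N] [Module Rᵐᵒᵖ N]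
    [SMulCommClass R Rᵐᵒᵖ N] (g : M →ₗ[Rᵐᵒᵖ] M') : BTensor R M N →ₗ[Rᵐᵒᵖ] BTensor R M' N where
  toFun := map g LinearMap.id
  map_add' := map_add _
  map_smul' r x := by
    induction x using induction_on with
    | tmul m n => rfl
    | add x y hx hy => simp only [smul_add, map_add, hx, hy]

theorem assoc_surjective {M N P : Type u} [AddCommGroup M] [Module Rᵐᵒᵖ M]
    [AddCommGroup N] [Module R N] [Module Rᵐᵒᵖ N] [SMulCommClass R Rᵐᵒᵖ N]
    [AddCommGroup P] [Module R P] : Function.Surjective (assoc R M N P) := fun y => by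
  induction y using induction_on with
  | tmul m x =>
    induction x using induction_on with
    | tmul n p => exact ⟨tmul R (tmul R m n) p, rfl⟩
    | add x y hx hy =>
      obtain ⟨x', hx⟩ := hx
      obtain ⟨y', hy⟩ := hy
      exact ⟨x' + y', by rw [map_add, hx, hy, tmul_add]⟩
  | add x y hx hy =>
    obtain ⟨x, rfl⟩ := hx
    obtain ⟨y, rfl⟩ := hy
    exact ⟨x + y, map_add _ _ _⟩

end Map

section ContractLeft

variable {R C M N : Type u} [Ring R] [AddCommGroup C] [Module Rᵐᵒᵖ C]
  [AddCommGroup M] [Module R M] [AddCommGroup N] [Module R N]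

variable (M) in
/-- The contraction `c ⊗ m ↦ f(c) m` along a right linear functional `f`. -/
noncomputable def contractLeft (f : C →ₗ[Rᵐᵒᵖ] R) : BTensor R C M →+ M :=
  (lid R M).comp (map f LinearMap.id)

@[simp] theorem contractLeft_tmul (f : C →ₗ[Rᵐᵒᵖ] R) (c : C) (m : M) :
    contractLeft M f (tmul R c m) = f c • m := rfl

theorem contractLeft_map (f : C →ₗ[Rᵐᵒᵖ] R) (g : M →ₗ[R] N) (x : BTensor R C M) :
    contractLeft N f (map LinearMap.id g x) = g (contractLeft M f x) := by
  induction x using induction_on with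
  | tmul c m => simp
  | add x y hx hy => simp only [map_add, hx, hy]

theorem contractLeft_smul [Module R C] [SMulCommClass R Rᵐᵒᵖ C] (f : C →ₗ[Rᵐᵒᵖ] R) (r : R)
    (x : BTensor R C M) :
    contractLeft M f (r • x) = contractLeft M (f ∘ₗ DistribSMul.toLinearMap Rᵐᵒᵖ C r) x := by
  induction x using induction_on with
  | tmul c m => simp
  | add x y hx hy => simp only [smul_add, map_add, hx, hy]

theorem exists_eq_sum_contractLeft {f : C → C →ₗ[Rᵐᵒᵖ] R}
    (hf : ∀ c, ∃ D : Finset C, ∀ D', D ⊆ D' → c = ∑ d ∈ D', op (f d c) • d)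
    (x : BTensor R C M) :
    ∃ D : Finset C, ∀ D', D ⊆ D' → x = ∑ d ∈ D', tmul R d (contractLeft M (f d) x) := by
  classical
  induction x using induction_on with
  | tmul c m =>
    obtain ⟨D, hD⟩ := hf c
    refine ⟨D, fun D' hD' => ?_⟩
    conv_lhs => rw [hD D' hD', ← mk_apply, map_sum, AddMonoidHom.finsetSum_apply]
    exact Finset.sum_congr rfl fun d _ => smul_tmul R _ _ _
  | add x y hx hy =>
    obtain ⟨D₁, h₁⟩ := hx
    obtain ⟨D₂, h₂⟩ := hy
    refine ⟨D₁ ∪ D₂, fun D' hD' => ?_⟩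
    conv_lhs => rw [h₁ D' (Finset.union_subset_left hD'), h₂ D' (Finset.union_subset_right hD')]
    simp only [map_add, tmul_add, Finset.sum_add_distrib]

theorem eq_zero_of_contractLeft (h : Module.Projective Rᵐᵒᵖ C) {x : BTensor R C M}
    (hx : ∀ f : C →ₗ[Rᵐᵒᵖ] R, contractLeft M f x = 0) : x = 0 := by
  obtain ⟨f, hf⟩ := exists_dualBasis_right h
  obtain ⟨D, hD⟩ := exists_eq_sum_contractLeft hf x
  rw [hD D subset_rfl]
  exact Finset.sum_eq_zero fun d _ => by rw [hx, tmul_zero]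

theorem map_injective_of_projective_left (h : Module.Projective Rᵐᵒᵖ C) {g : M →ₗ[R] N}
    (hg : Function.Injective g) :
    Function.Injective (map (LinearMap.id : C →ₗ[Rᵐᵒᵖ] C) g) := by
  refine (injective_iff_map_eq_zero _).2 fun x hx => eq_zero_of_contractLeft h fun f => ?_
  have := contractLeft_map f g x
  rw [hx, map_zero] at this
  exact (injective_iff_map_eq_zero g).1 hg _ this.symm

end ContractLeft

theorem eq_of_forall_functional {R C : Type u} [Ring R] [AddCommGroup C] [Module Rᵐᵒᵖ C]
    (h : Module.Projective Rᵐᵒᵖ C) {c c' : C} (hc : ∀ f : C →ₗ[Rᵐᵒᵖ] R, f c = f c') : c = c' := by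
  obtain ⟨f, hf⟩ := exists_dualBasis_right h
  obtain ⟨D, hD⟩ := hf c
  obtain ⟨D', hD'⟩ := hf c'
  classical
  rw [hD (D ∪ D') Finset.subset_union_left, hD' (D ∪ D') Finset.subset_union_right]
  exact Finset.sum_congr rfl fun d _ => by rw [hc]

section ContractRight

variable {R X Y M N : Type u} [Ring R] [AddCommGroup X] [Module R X] [AddCommGroup Y] [Module R Y]
  [AddCommGroup M] [Module Rᵐᵒᵖ M] [AddCommGroup N] [Module Rᵐᵒᵖ N]

variable (M) in
/-- The contraction `m ⊗ x ↦ m f(x)` along a left linear functional `f`. -/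
noncomputable def contractRight (f : X →ₗ[R] R) : BTensor R M X →+ M :=
  (rid R M).comp (map LinearMap.id f)

@[simp] theorem contractRight_tmul (f : X →ₗ[R] R) (m : M) (x : X) :
    contractRight M f (tmul R m x) = op (f x) • m := rfl

theorem contractRight_map (f : X →ₗ[R] R) (g : M →ₗ[Rᵐᵒᵖ] N) (x : BTensor R M X) :
    contractRight N f (map g LinearMap.id x) = g (contractRight M f x) := by
  induction x using induction_on with
  | tmul c m => simp
  | add x y hx hy => simp only [map_add, hx, hy]

theorem contractRight_comp (f : Y →ₗ[R] R) (k : X →ₗ[R] Y) (x : BTensor R M X) :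
    contractRight M f (map LinearMap.id k x) = contractRight M (f ∘ₗ k) x := by
  induction x using induction_on with
  | tmul c m => simp
  | add x y hx hy => simp only [map_add, hx, hy]

theorem exists_eq_sum_contractRight {f : X → X →ₗ[R] R}
    (hf : ∀ c, ∃ D : Finset X, ∀ D', D ⊆ D' → c = ∑ d ∈ D', f d c • d)
    (x : BTensor R M X) :
    ∃ D : Finset X, ∀ D', D ⊆ D' → x = ∑ d ∈ D', tmul R (contractRight M (f d) x) d := by
  classical
  induction x using induction_on with
  | tmul m c =>
    obtain ⟨D, hD⟩ := hf c
    refine ⟨D, fun D' hD' => ?_⟩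
    conv_lhs => rw [hD D' hD', ← mk_apply, map_sum]
    exact Finset.sum_congr rfl fun d _ => (smul_tmul R _ _ _).symm
  | add x y hx hy =>
    obtain ⟨D₁, h₁⟩ := hx
    obtain ⟨D₂, h₂⟩ := hy
    refine ⟨D₁ ∪ D₂, fun D' hD' => ?_⟩
    conv_lhs => rw [h₁ D' (Finset.union_subset_left hD'), h₂ D' (Finset.union_subset_right hD')]
    simp only [map_add, add_tmul, Finset.sum_add_distrib]

variable (R X) in
/-- Tensors in `N ⊗_R X` are determined by their contractions along functionals on `X`. -/
def IsSeparated : Prop :=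
  ∀ (N : Type u) [AddCommGroup N] [Module Rᵐᵒᵖ N] (x : BTensor R N X),
    (∀ f : X →ₗ[R] R, contractRight N f x = 0) → x = 0

theorem IsSeparated.map_injective (h : IsSeparated R X) {g : M →ₗ[Rᵐᵒᵖ] N}
    (hg : Function.Injective g) :
    Function.Injective (map g (LinearMap.id : X →ₗ[R] X)) := by
  refine (injective_iff_map_eq_zero _).2 fun x hx => h _ _ fun f => ?_
  have := contractRight_map f g x
  rw [hx, map_zero] at this
  exact (injective_iff_map_eq_zero g).1 hg _ this.symm

/-- `X ⊗_R f` followed by `X ⊗_R R = X`, as a left linear map, for a bimodule `X`. -/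
noncomputable def contractRightLinear (X : Type u) [AddCommGroup X] [Module R X] [Module Rᵐᵒᵖ X]
    [SMulCommClass R Rᵐᵒᵖ X] (f : Y →ₗ[R] R) : BTensor R X Y →ₗ[R] X where
  toFun := contractRight X f
  map_add' := map_add _
  map_smul' r x := by
    induction x using induction_on with
    | tmul m n => exact (smul_comm r (op (f n)) m).symm
    | add x y hx hy => simp only [smul_add, map_add, hx, hy]

theorem map_contractRightLinear_assoc {X : Type u} [AddCommGroup X] [Module R X] [Module Rᵐᵒᵖ X]
    [SMulCommClass R Rᵐᵒᵖ X] (f : Y →ₗ[R] R) (z : BTensor R (BTensor R M X) Y) :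
    map LinearMap.id (contractRightLinear X f) (assoc R M X Y z) = contractRight _ f z := by
  induction z using induction_on with
  | tmul w y =>
    induction w using induction_on with
    | tmul m x => rfl
    | add w w' hw hw' => rw [add_tmul, map_add, map_add, map_add, hw, hw']
  | add x y hx hy => simp only [map_add, hx, hy]

/-- Contracting along `g` on `Y` and then along `f` on `X` is contracting along one functional on `X
⊗_R Y`. Coassociativity needs this for `C ⊗_R C`. -/
theorem IsSeparated.tensor {X : Type u} [AddCommGroup X] [Module R X] [Module Rᵐᵒᵖ X]
    [SMulCommClass R Rᵐᵒᵖ X] (hX : IsSeparated R X) (hY : IsSeparated R Y) :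
    IsSeparated R (BTensor R X Y) := fun N _ _ y hy => by
  obtain ⟨z, rfl⟩ := assoc_surjective y
  have : z = 0 := hY _ _ fun g => hX _ _ fun f => by
    rw [← map_contractRightLinear_assoc, contractRight_comp]
    exact hy _
  rw [this, map_zero]

end ContractRight

section DualTensor

variable {R L X : Type u} [Ring R] [AddCommGroup L] [Module R L] [AddCommGroup X] [Module R X]

variable (R L X) in
/-- The map `Hom_R(L, R) ⊗_R X → Hom_R(L, X)`, `ξ ⊗ x ↦ (l ↦ ξ(l) x)`. -/
noncomputable def dualTensor : BTensor R (L →ₗ[R] R) X →+ (L →ₗ[R] X) :=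
  lift (AddMonoidHom.mk' (fun ξ => AddMonoidHom.mk' (fun x => ξ.smulRight x)
      fun x y => by ext l; exact smul_add _ _ _)
    fun ξ η => by ext x l; exact add_smul _ _ _) fun r ξ x => by
      ext l
      exact mul_smul (ξ l) r x

@[simp] theorem dualTensor_tmul (ξ : L →ₗ[R] R) (x : X) (l : L) :
    dualTensor R L X (tmul R ξ x) l = ξ l • x := rfl

theorem functional_dualTensor (f : X →ₗ[R] R) (x : BTensor R (L →ₗ[R] R) X) (l : L) :
    f (dualTensor R L X x l) = contractRight (L →ₗ[R] R) f x l := by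
  induction x using induction_on with
  | tmul ξ x => rw [dualTensor_tmul, map_smul]; rfl
  | add x y hx hy => simp only [map_add, LinearMap.add_apply, hx, hy]

/-- Applying `f : X → R` to the values of the map gives the contraction of the tensor along `f`, so
a tensor giving the zero map has only zero contractions. -/
theorem dualTensor_injective (hX : IsSeparated R X) : Function.Injective (dualTensor R L X) := by
  refine (injective_iff_map_eq_zero _).2 fun x hx => hX _ _ fun f => ?_
  ext l
  rw [← functional_dualTensor, hx]
  exact map_zero f

/-- The images under `k` of finitely many generators of `L` expand over one finite part of a dual
basis, and there `k` is the image of the sum of the `(f d ∘ k) ⊗ d`. -/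
theorem dualTensor_surjective (h : Module.Projective R X) [Module.Finite R L] :
    Function.Surjective (dualTensor R L X) := fun k => by
  classical
  obtain ⟨f, hf⟩ := exists_dualBasis h
  choose D hD using hf
  obtain ⟨G, hG⟩ := (Module.finite_def (R := R) (M := L)).1 inferInstance
  refine ⟨∑ d ∈ G.biUnion fun l => D (k l), tmul R (f d ∘ₗ k) d, ?_⟩
  refine LinearMap.ext_on hG fun l hl => ?_
  rw [map_sum, LinearMap.sum_apply]
  exact (hD (k l) _ (Finset.subset_biUnion_of_mem (fun l => D (k l)) hl)).symm

theorem dualTensor_map_right {Y : Type u} [AddCommGroup Y] [Module R Y] (g : X →ₗ[R] Y)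
    (x : BTensor R (L →ₗ[R] R) X) (l : L) :
    dualTensor R L Y (map LinearMap.id g x) l = g (dualTensor R L X x l) := by
  induction x using induction_on with
  | tmul ξ x => simp
  | add x y hx hy => simp only [map_add, LinearMap.add_apply, hx, hy]

theorem dualTensor_smul [Module Rᵐᵒᵖ X] [SMulCommClass R Rᵐᵒᵖ X] (r : Rᵐᵒᵖ)
    (x : BTensor R (L →ₗ[R] R) X) (l : L) :
    dualTensor R L X (r • x) l = r • dualTensor R L X x l := by
  induction x using induction_on with
  | tmul ξ x => exact smul_comm (ξ l) r x
  | add x y hx hy => simp only [smul_add, map_add, LinearMap.add_apply, hx, hy]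

end DualTensor

end BTensor

open BTensor

/-! ### Left comodules -/

section LeftComodules

variable {R C : Type u} [Ring R]
  [AddCommGroup C] [Module R C] [Module Rᵐᵒᵖ C] [SMulCommClass R Rᵐᵒᵖ C] [Coring R C]
  {M N : Type u} [AddCommGroup M] [Module R M] [LeftComodule R C M]
  [AddCommGroup N] [Module R N] [LeftComodule R C N]

variable (M) in
/-- The action `m ↦ f(m₋₁) m₀` of a right linear functional `f` on a left comodule. -/
noncomputable def leftAct (f : C →ₗ[Rᵐᵒᵖ] R) : M →+ M :=
  (contractLeft M f).comp (LeftComodule.coact (R := R) (C := C)).toAddMonoidHom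

theorem leftAct_apply (f : C →ₗ[Rᵐᵒᵖ] R) (m : M) :
    leftAct M f m = contractLeft M f (LeftComodule.coact (R := R) (C := C) m) := rfl

theorem leftAct_counit (m : M) :
    leftAct M (Coring.counit (R := R) (C := C)).toRightLinearMap m = m :=
  LeftComodule.counit m

theorem leftAct_smul (f : C →ₗ[Rᵐᵒᵖ] R) (r : R) (m : M) :
    leftAct M f (r • m) = leftAct M (f ∘ₗ DistribSMul.toLinearMap Rᵐᵒᵖ C r) m := by
  rw [leftAct_apply, map_smul, contractLeft_smul]
  rfl

theorem LeftColinear.map_leftAct {g : M →ₗ[R] N} (hg : LeftColinear C g) (f : C →ₗ[Rᵐᵒᵖ] R)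
    (m : M) : leftAct N f (g m) = g (leftAct M f m) := by
  rw [leftAct_apply, hg, contractLeft_map]
  rfl

theorem leftAct_leftAct (f g : C →ₗ[Rᵐᵒᵖ] R) (m : M) :
    leftAct M g (leftAct M f m) = contractLeft M g (contractLeft _ f
      (assoc R C C M (map (Coring.comul (R := R) (C := C)).toRightLinearMap LinearMap.id
        (LeftComodule.coact (R := R) (C := C) m)))) := by
  rw [LeftComodule.coassoc, contractLeft_map]
  rfl

theorem IsLeftSubcomodule.leftAct_mem {L : Submodule R M} (hL : IsLeftSubcomodule C L)
    (f : C →ₗ[Rᵐᵒᵖ] R) {m : M} (hm : m ∈ L) : leftAct M f m ∈ L := by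
  obtain ⟨_, h⟩ := hL
  have h1 := h.map_leftAct f ⟨m, hm⟩
  rw [Submodule.subtype_apply, Submodule.subtype_apply] at h1
  rw [h1]
  exact Subtype.property _

/-- A submodule of a left comodule which is stable under the functionals is a subcomodule. -/
theorem isLeftSubcomodule_of_leftAct_mem (hright : Module.Projective Rᵐᵒᵖ C) {L : Submodule R M}
    (h : ∀ (f : C →ₗ[Rᵐᵒᵖ] R), ∀ m ∈ L, leftAct M f m ∈ L) : IsLeftSubcomodule C L := by
  let ι : BTensor R C L →ₗ[R] BTensor R C M := mapLeftLinear C L.subtype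
  have hι : Function.Injective ι :=
    map_injective_of_projective_left hright L.subtype_injective
  -- The coefficients of the coaction of `l` in a dual basis of `C` are the elements `leftAct M (f
  -- d) l`, which stay in `L`.
  have hmem : ∀ l : L, LeftComodule.coact (R := R) (C := C) (l : M) ∈ LinearMap.range ι := by
    intro l
    obtain ⟨f, hf⟩ := exists_dualBasis_right hright
    obtain ⟨D, hD⟩ := exists_eq_sum_contractLeft hf (LeftComodule.coact (R := R) (C := C) (l : M))
    rw [hD D subset_rfl]
    exact Submodule.sum_mem _ fun d _ =>
      ⟨tmul R d (⟨_, h (f d) l l.2⟩ : L), rfl⟩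
  let ρ : L →ₗ[R] BTensor R C L := (LinearEquiv.ofInjective ι hι).symm.toLinearMap ∘ₗ
    LinearMap.codRestrict (LinearMap.range ι)
      (LeftComodule.coact (R := R) (C := C) ∘ₗ L.subtype) hmem
  have hρ : ∀ l, ι (ρ l) = LeftComodule.coact (R := R) (C := C) (l : M) := fun l =>
    congrArg Subtype.val ((LinearEquiv.ofInjective ι hι).apply_symm_apply ⟨_, hmem l⟩)
  -- Coassociativity in `L` can be checked after embedding `C ⊗_R (C ⊗_R L)` in `C ⊗_R (C ⊗_R M)`.
  have hι' : Function.Injective (map (LinearMap.id : C →ₗ[Rᵐᵒᵖ] C) ι) :=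
    map_injective_of_projective_left hright hι
  refine ⟨⟨ρ, fun l => hι' ?_, fun l => L.subtype_injective ?_⟩, fun l => (hρ l).symm⟩
  · have h1 := LeftComodule.coassoc (R := R) (C := C) (l : M)
    rw [← hρ] at h1
    have h2 : ι ∘ₗ ρ = LeftComodule.coact (R := R) (C := C) ∘ₗ L.subtype := LinearMap.ext hρ
    rw [map_map, h2, ← map_map (LinearMap.id : C →ₗ[Rᵐᵒᵖ] C) L.subtype]
    refine Eq.trans ?_ h1
    generalize ρ l = x
    induction x using BTensor.induction_on with
    | tmul c l =>
      change map LinearMap.id ι (assoc R C C L (tmul R (Coring.comul.toLinearMap c) l)) =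
        assoc R C C M (tmul R (Coring.comul.toLinearMap c) (l : M))
      generalize (Coring.comul (R := R) (C := C)).toLinearMap c = y
      induction y using BTensor.induction_on with
      | tmul c d => rfl
      | add x y hx hy => simp only [add_tmul, map_add, hx, hy]
    | add x y hx hy => simp only [map_add, hx, hy]
  · refine Eq.trans ?_ (LeftComodule.counit (R := R) (C := C) (l : M))
    rw [← hρ]
    exact (contractLeft_map (Coring.counit (R := R) (C := C)).toRightLinearMap L.subtype _).symm

/-- Every element of a left comodule lies in a finitely generated subcomodule. -/
theorem exists_fg_leftSubcomodule (hright : Module.Projective Rᵐᵒᵖ C) (m : M) :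
    ∃ L : Submodule R M, IsLeftSubcomodule C L ∧ L.FG ∧ m ∈ L := by
  classical
  obtain ⟨f, hf⟩ := exists_dualBasis_right hright
  obtain ⟨D, hD⟩ := exists_eq_sum_contractLeft hf (LeftComodule.coact (R := R) (C := C) m)
  replace hD := hD D subset_rfl
  let G : Finset M := D.image fun d => leftAct M (f d) m
  have hG : ∀ d ∈ D, leftAct M (f d) m ∈ Submodule.span R (G : Set M) := fun d hd =>
    Submodule.subset_span (Finset.mem_image_of_mem _ hd)
  have hact : ∀ g : C →ₗ[Rᵐᵒᵖ] R, leftAct M g m ∈ Submodule.span R (G : Set M) := fun g => by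
    rw [leftAct_apply, hD, map_sum]
    exact Submodule.sum_mem _ fun d hd => Submodule.smul_mem _ _ (hG d hd)
  refine ⟨Submodule.span R (G : Set M), ?_, ⟨G, rfl⟩, ?_⟩
  · refine isLeftSubcomodule_of_leftAct_mem hright fun g n hn => ?_
    induction hn using Submodule.span_induction generalizing g with
    | mem n hn =>
      obtain ⟨e, -, rfl⟩ := Finset.mem_image.1 (Finset.mem_coe.1 hn)
      -- By coassociativity the second action only contracts `Δ d`, so the result is again a left
      -- combination of the generators `leftAct M (f d) m`.
      rw [leftAct_leftAct, hD, map_sum, map_sum, map_sum, map_sum]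
      refine Submodule.sum_mem _ fun d hd => ?_
      rw [map_tmul]
      generalize (Coring.comul (R := R) (C := C)).toRightLinearMap d = y
      induction y using BTensor.induction_on with
      | tmul a b => exact Submodule.smul_mem _ _ (hG d hd)
      | add x y hx hy =>
        simp only [add_tmul, map_add]
        exact add_mem hx hy
    | zero => rw [map_zero]; exact zero_mem _
    | add x y _ _ hx hy => rw [map_add]; exact add_mem (hx g) (hy g)
    | smul r x _ hx => rw [leftAct_smul]; exact hx _
  · rw [← leftAct_counit (R := R) (C := C) m]
    exact hact _

/-- The quotient of a left comodule by a subcomodule. -/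
theorem exists_leftComodule_quotient {L : Submodule R M} (hL : IsLeftSubcomodule C L) :
    ∃ _ : LeftComodule R C (M ⧸ L), LeftColinear C L.mkQ := by
  let π : BTensor R C M →ₗ[R] BTensor R C (M ⧸ L) := mapLeftLinear C L.mkQ
  have hker : L ≤ LinearMap.ker (π ∘ₗ LeftComodule.coact (R := R) (C := C)) := fun l hl => by
    obtain ⟨_, h⟩ := hL
    have h1 := h ⟨l, hl⟩
    rw [LinearMap.mem_ker, LinearMap.comp_apply]
    rw [Submodule.subtype_apply] at h1
    rw [h1]
    generalize LeftComodule.coact (R := R) (C := C) (⟨l, hl⟩ : L) = x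
    induction x using BTensor.induction_on with
    | tmul c l =>
      change tmul R c (L.mkQ l) = 0
      rw [Submodule.mkQ_apply, (Submodule.Quotient.mk_eq_zero L).2 l.2, tmul_zero]
    | add x y hx hy => rw [map_add, map_add, hx, hy, add_zero]
  let ρ : (M ⧸ L) →ₗ[R] BTensor R C (M ⧸ L) := L.liftQ _ hker
  have hρ : ρ ∘ₗ L.mkQ = π ∘ₗ LeftComodule.coact (R := R) (C := C) := L.liftQ_mkQ _ _
  have hρ' : ∀ m, ρ (L.mkQ m) =
      map LinearMap.id L.mkQ (LeftComodule.coact (R := R) (C := C) m) := fun m => rfl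
  refine ⟨⟨ρ, fun m => ?_, fun m => ?_⟩, fun m => rfl⟩
  · obtain ⟨m, rfl⟩ := L.mkQ_surjective m
    rw [hρ', map_map, map_map, hρ]
    have h1 := congrArg (map LinearMap.id π) (LeftComodule.coassoc (R := R) (C := C) m)
    rw [map_map] at h1
    refine Eq.trans ?_ h1
    generalize LeftComodule.coact (R := R) (C := C) m = x
    induction x using BTensor.induction_on with
    | tmul c m =>
      change assoc R C C (M ⧸ L) (tmul R (Coring.comul.toLinearMap c) (L.mkQ m)) =
        map LinearMap.id π (assoc R C C M (tmul R (Coring.comul.toLinearMap c) m))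
      generalize (Coring.comul (R := R) (C := C)).toLinearMap c = y
      induction y using BTensor.induction_on with
      | tmul c d => rfl
      | add x y hx hy => simp only [add_tmul, map_add, hx, hy]
    | add x y hx hy => simp only [map_add, hx, hy]
  · obtain ⟨m, rfl⟩ := L.mkQ_surjective m
    refine Eq.trans ?_ (congrArg L.mkQ (LeftComodule.counit (R := R) (C := C) m))
    exact contractLeft_map (Coring.counit (R := R) (C := C)).toRightLinearMap L.mkQ _

end LeftComodules

/-! ### Right comodules -/

section RightComodules

variable {R C : Type u} [Ring R]
  [AddCommGroup C] [Module R C] [Module Rᵐᵒᵖ C] [SMulCommClass R Rᵐᵒᵖ C] [Coring R C]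
  {M N : Type u} [AddCommGroup M] [Module Rᵐᵒᵖ M] [RightComodule R C M]
  [AddCommGroup N] [Module Rᵐᵒᵖ N] [RightComodule R C N]

variable (M) in
/-- The action `m ↦ m₀ f(m₁)` of a left linear functional `f` on a right comodule. -/
noncomputable def rightAct (f : C →ₗ[R] R) : M →+ M :=
  (contractRight M f).comp (RightComodule.coact (R := R) (C := C)).toAddMonoidHom

theorem rightAct_apply (f : C →ₗ[R] R) (m : M) :
    rightAct M f m = contractRight M f (RightComodule.coact (R := R) (C := C) m) := rfl

theorem rightAct_counit (m : M) :
    rightAct M (Coring.counit (R := R) (C := C)).toLinearMap m = m :=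
  RightComodule.counit m

theorem exists_rightAct_smul (f : C →ₗ[R] R) (r : Rᵐᵒᵖ) :
    ∃ g : C →ₗ[R] R, ∀ m : M, rightAct M f (r • m) = rightAct M g m := by
  refine ⟨f ∘ₗ { toFun := fun c => r • c
                 map_add' := smul_add r
                 map_smul' := fun s c => (smul_comm s r c).symm }, fun m => ?_⟩
  rw [rightAct_apply, map_smul, rightAct_apply]
  generalize RightComodule.coact (R := R) (C := C) m = x
  induction x using BTensor.induction_on with
  | tmul m c => rfl
  | add x y hx hy => simp only [smul_add, map_add, hx, hy]

theorem RightColinear.map_rightAct {g : M →ₗ[Rᵐᵒᵖ] N} (hg : RightColinear C g) (f : C →ₗ[R] R)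
    (m : M) : rightAct N f (g m) = g (rightAct M f m) := by
  rw [rightAct_apply, hg, contractRight_map]
  rfl

theorem rightAct_rightAct (f g : C →ₗ[R] R) (m : M) :
    rightAct M g (rightAct M f m) = contractRight M g (map LinearMap.id (contractRightLinear C f)
      (map LinearMap.id (Coring.comul (R := R) (C := C)).toLinearMap
        (RightComodule.coact (R := R) (C := C) m))) := by
  rw [← RightComodule.coassoc, map_contractRightLinear_assoc, contractRight_map]
  rfl

theorem IsRightSubcomodule.rightAct_mem {L : Submodule Rᵐᵒᵖ M} (hL : IsRightSubcomodule C L)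
    (f : C →ₗ[R] R) {m : M} (hm : m ∈ L) : rightAct M f m ∈ L := by
  obtain ⟨_, h⟩ := hL
  have h1 := h.map_rightAct f ⟨m, hm⟩
  rw [Submodule.subtype_apply, Submodule.subtype_apply] at h1
  rw [h1]
  exact Subtype.property _

/-- A submodule of a right comodule which is stable under the functionals is a subcomodule. -/
theorem isRightSubcomodule_of_rightAct_mem (hleft : Module.Projective R C) (hC : IsSeparated R C)
    {L : Submodule Rᵐᵒᵖ M}
    (h : ∀ (f : C →ₗ[R] R), ∀ m ∈ L, rightAct M f m ∈ L) : IsRightSubcomodule C L := by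
  let ι : BTensor R L C →ₗ[Rᵐᵒᵖ] BTensor R M C := mapRightLinear C L.subtype
  have hι : Function.Injective ι := hC.map_injective L.subtype_injective
  have hmem : ∀ l : L, RightComodule.coact (R := R) (C := C) (l : M) ∈ LinearMap.range ι := by
    intro l
    obtain ⟨f, hf⟩ := exists_dualBasis hleft
    obtain ⟨D, hD⟩ := exists_eq_sum_contractRight hf
      (RightComodule.coact (R := R) (C := C) (l : M))
    rw [hD D subset_rfl]
    exact Submodule.sum_mem _ fun d _ =>
      ⟨tmul R (⟨_, h (f d) l l.2⟩ : L) d, rfl⟩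
  let ρ : L →ₗ[Rᵐᵒᵖ] BTensor R L C := (LinearEquiv.ofInjective ι hι).symm.toLinearMap ∘ₗ
    LinearMap.codRestrict (LinearMap.range ι)
      (RightComodule.coact (R := R) (C := C) ∘ₗ L.subtype) hmem
  have hρ : ∀ l, ι (ρ l) = RightComodule.coact (R := R) (C := C) (l : M) := fun l =>
    congrArg Subtype.val ((LinearEquiv.ofInjective ι hι).apply_symm_apply ⟨_, hmem l⟩)
  -- Coassociativity is compared in `M ⊗_R (C ⊗_R C)`, so separatedness of `C ⊗_R C` is needed here.
  have hι' : Function.Injective (map L.subtype (LinearMap.id : BTensor R C C →ₗ[R] _)) :=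
    (hC.tensor hC).map_injective L.subtype_injective
  refine ⟨⟨ρ, fun l => hι' ?_, fun l => L.subtype_injective ?_⟩, fun l => (hρ l).symm⟩
  · have h1 := RightComodule.coassoc (R := R) (C := C) (l : M)
    rw [← hρ] at h1
    refine Eq.trans ?_ (h1.trans ?_)
    · generalize ρ l = x
      induction x using BTensor.induction_on with
      | tmul l c =>
        change map L.subtype LinearMap.id (assoc R L C C (tmul R (ρ l) c)) =
          assoc R M C C (tmul R (RightComodule.coact (R := R) (C := C) (l : M)) c)
        rw [← hρ]
        generalize ρ l = y
        induction y using BTensor.induction_on with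
        | tmul l d => rfl
        | add x y hx hy => simp only [add_tmul, map_add, hx, hy]
      | add x y hx hy => simp only [map_add, hx, hy]
    · rw [map_map]
      exact map_map _ _ _ _ _
  · refine Eq.trans ?_ (RightComodule.counit (R := R) (C := C) (l : M))
    rw [← hρ]
    exact (contractRight_map (Coring.counit (R := R) (C := C)).toLinearMap L.subtype _).symm

/-- Every element of a right comodule lies in a finitely generated subcomodule. -/
theorem exists_fg_rightSubcomodule (hleft : Module.Projective R C) (hC : IsSeparated R C) (m : M) :
    ∃ L : Submodule Rᵐᵒᵖ M, IsRightSubcomodule C L ∧ L.FG ∧ m ∈ L := by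
  classical
  obtain ⟨f, hf⟩ := exists_dualBasis hleft
  obtain ⟨D, hD⟩ := exists_eq_sum_contractRight hf (RightComodule.coact (R := R) (C := C) m)
  replace hD := hD D subset_rfl
  let G : Finset M := D.image fun d => rightAct M (f d) m
  have hG : ∀ d ∈ D, rightAct M (f d) m ∈ Submodule.span Rᵐᵒᵖ (G : Set M) := fun d hd =>
    Submodule.subset_span (Finset.mem_image_of_mem _ hd)
  have hact : ∀ g : C →ₗ[R] R, rightAct M g m ∈ Submodule.span Rᵐᵒᵖ (G : Set M) := fun g => by
    rw [rightAct_apply, hD, map_sum]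
    exact Submodule.sum_mem _ fun d hd => Submodule.smul_mem _ _ (hG d hd)
  refine ⟨Submodule.span Rᵐᵒᵖ (G : Set M), ?_, ⟨G, rfl⟩, ?_⟩
  · refine isRightSubcomodule_of_rightAct_mem hleft hC fun g n hn => ?_
    induction hn using Submodule.span_induction generalizing g with
    | mem n hn =>
      obtain ⟨e, -, rfl⟩ := Finset.mem_image.1 (Finset.mem_coe.1 hn)
      rw [rightAct_rightAct, hD, map_sum, map_sum, map_sum]
      refine Submodule.sum_mem _ fun d hd => ?_
      exact Submodule.smul_mem _ _ (hG d hd)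
    | zero => rw [map_zero]; exact zero_mem _
    | add x y _ _ hx hy => rw [map_add]; exact add_mem (hx g) (hy g)
    | smul r x _ hx =>
      obtain ⟨g', hg'⟩ := exists_rightAct_smul (M := M) g r
      rw [hg']
      exact hx g'
  · rw [← rightAct_counit (R := R) (C := C) m]
    exact hact _

end RightComodules

/-! ### The dual of a finitely generated left comodule -/

section Dual

theorem functional_contractRight {R C L : Type u} [Ring R] [AddCommGroup C] [Module Rᵐᵒᵖ C]
    [AddCommGroup L] [Module R L] (f : C →ₗ[Rᵐᵒᵖ] R)
    (ξ : L →ₗ[R] R) (x : BTensor R C L) :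
    f (contractRight C ξ x) = ξ (contractLeft L f x) := by
  induction x using BTensor.induction_on with
  | tmul c l => simp
  | add x y hx hy => simp only [map_add, hx, hy]

theorem map_add_right {R M N N' : Type u} [Ring R] [AddCommGroup M] [Module Rᵐᵒᵖ M]
    [AddCommGroup N] [Module R N] [AddCommGroup N'] [Module R N'] (g g' : N →ₗ[R] N')
    (x : BTensor R M N) :
    map (LinearMap.id : M →ₗ[Rᵐᵒᵖ] M) (g + g') x = map LinearMap.id g x + map LinearMap.id g' x := by
  induction x using BTensor.induction_on with
  | tmul c l => exact tmul_add R _ _ _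
  | add x y hx hy =>
    rw [map_add, hx, hy, map_add, map_add]
    abel

variable {R C : Type u} [Ring R]
  [AddCommGroup C] [Module R C] [Module Rᵐᵒᵖ C] [SMulCommClass R Rᵐᵒᵖ C] [Coring R C]
  {L : Type u} [AddCommGroup L] [Module R L] [LeftComodule R C L]

variable (R C L) in
/-- The right comodule structures on `Hom_R(L, R)` that correspond to the transpose of the
coaction of `L` under `Hom_R(L, R) ⊗_R C → Hom_R(L, C)`. -/
def IsDualCoaction [RightComodule R C (L →ₗ[R] R)] : Prop :=
  ∀ (ξ : L →ₗ[R] R) (l : L), dualTensor R L C (RightComodule.coact (R := R) (C := C) ξ) l =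
    contractRight C ξ (LeftComodule.coact (R := R) (C := C) l)

theorem exists_isDualCoaction (hleft : Module.Projective R C) (hC : IsSeparated R C)
    [Module.Finite R L] :
    ∃ _ : RightComodule R C (L →ₗ[R] R), IsDualCoaction R C L := by
  have hinj : Function.Injective (dualTensor R L C) := dualTensor_injective hC
  choose ρ hρ using fun ξ : L →ₗ[R] R => dualTensor_surjective hleft
    (contractRightLinear C ξ ∘ₗ LeftComodule.coact (R := R) (C := C) (M := L))
  have hρ' : ∀ ξ l, dualTensor R L C (ρ ξ) l =
      contractRight C ξ (LeftComodule.coact (R := R) (C := C) l) := fun ξ l => by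
    rw [hρ]
    rfl
  let δ : (L →ₗ[R] R) →ₗ[Rᵐᵒᵖ] BTensor R (L →ₗ[R] R) C :=
    { toFun := ρ
      map_add' := fun ξ η => hinj <| LinearMap.ext fun l => by
        rw [map_add, LinearMap.add_apply, hρ', hρ', hρ']
        generalize LeftComodule.coact (R := R) (C := C) l = x
        induction x using BTensor.induction_on with
        | tmul c l => simp [add_smul]
        | add x y hx hy =>
          simp only [map_add, hx, hy]
          abel
      map_smul' := fun r ξ => hinj <| LinearMap.ext fun l => by
        rw [RingHom.id_apply, dualTensor_smul, hρ', hρ']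
        generalize LeftComodule.coact (R := R) (C := C) l = x
        induction x using BTensor.induction_on with
        | tmul c l =>
          rw [contractRight_tmul, contractRight_tmul, smul_smul]
          rfl
        | add x y hx hy => simp only [map_add, smul_add, hx, hy] }
  -- Seen in `Hom_R(L, C ⊗_R C)`, applying `δ ⊗ C` amounts to precomposing with the coaction of `L`.
  -- Coassociativity of `δ` thus becomes that of `L`.
  have hassoc : ∀ (x : BTensor R (L →ₗ[R] R) C) (l : L),
      dualTensor R L (BTensor R C C) (assoc R _ C C (map δ LinearMap.id x)) l =
        map LinearMap.id (dualTensor R L C x) (LeftComodule.coact (R := R) (C := C) l) :=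
    fun x l => by
      induction x using BTensor.induction_on with
      | tmul η c =>
        have h1 : ∀ w : BTensor R (L →ₗ[R] R) C,
            dualTensor R L (BTensor R C C) (assoc R _ C C (tmul R w c)) l =
              tmul R (dualTensor R L C w l) c := fun w => by
          induction w using BTensor.induction_on with
          | tmul η d => rfl
          | add x y hx hy => simp only [add_tmul, map_add, LinearMap.add_apply, hx, hy]
        refine (h1 (ρ η)).trans ?_
        rw [hρ']
        generalize LeftComodule.coact (R := R) (C := C) l = y
        induction y using BTensor.induction_on with
        | tmul d l => exact smul_tmul R _ _ _
        | add x y hx hy => simp only [add_tmul, map_add, hx, hy]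
      | add x y hx hy => simp only [map_add, LinearMap.add_apply, hx, hy, map_add_right]
  refine ⟨⟨δ, fun ξ => dualTensor_injective (hC.tensor hC) <| LinearMap.ext fun l => ?_,
    fun ξ => LinearMap.ext fun l => ?_⟩, hρ'⟩
  · rw [hassoc, dualTensor_map_right]
    change map LinearMap.id (dualTensor R L C (ρ ξ)) _ =
      Coring.comul.toLinearMap (dualTensor R L C (ρ ξ) l)
    rw [hρ', hρ]
    refine (map_map (LinearMap.id : C →ₗ[Rᵐᵒᵖ] C) LeftComodule.coact LinearMap.id
      (contractRightLinear C ξ) _).symm.trans ?_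
    rw [← LeftComodule.coassoc, map_contractRightLinear_assoc, contractRight_map]
    rfl
  · refine (functional_dualTensor (Coring.counit (R := R) (C := C)).toLinearMap (ρ ξ) l).symm.trans ?_
    rw [hρ']
    refine (functional_contractRight (Coring.counit (R := R) (C := C)).toRightLinearMap ξ _).trans ?_
    exact congrArg ξ (LeftComodule.counit (R := R) (C := C) l)

/-- Pairings `L × P → R`, as maps `L → Hom_R(P, R)`, which are compatible with the coactions. -/
def IsColinearPairing {P : Type u} [AddCommGroup P] [Module Rᵐᵒᵖ P] [RightComodule R C P]
    (φ : L →ₗ[R] P →ₗ[Rᵐᵒᵖ] R) : Prop :=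
  ∀ (f : C →ₗ[Rᵐᵒᵖ] R) (l : L) (p : P), φ (leftAct L f l) p =
    f (contractLeft C (φ l) (RightComodule.coact (R := R) (C := C) p))

/-- `dualTensor` turns colinearity into the identity `l₋₁ φ(l₀, p) = φ(l, p₀) p₁` in `C`. The right
linear functionals `f` separate points of `C`, so testing with them loses nothing. -/
theorem rightColinear_iff_isColinearPairing (hright : Module.Projective Rᵐᵒᵖ C)
    (hC : IsSeparated R C) [RightComodule R C (L →ₗ[R] R)] (hL : IsDualCoaction R C L)
    {P : Type u} [AddCommGroup P] [Module Rᵐᵒᵖ P] [RightComodule R C P]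
    (h : P →ₗ[Rᵐᵒᵖ] L →ₗ[R] R) :
    RightColinear C h ↔ IsColinearPairing (C := C) h.flip := by
  have key : ∀ (x : BTensor R P C) (l : L),
      dualTensor R L C (map h LinearMap.id x) l = contractLeft C (h.flip l) x := fun x l => by
    induction x using BTensor.induction_on with
    | tmul p c => rfl
    | add x y hx hy => simp only [map_add, LinearMap.add_apply, hx, hy]
  have key' : ∀ (f : C →ₗ[Rᵐᵒᵖ] R) (p : P) (l : L),
      f (dualTensor R L C (RightComodule.coact (R := R) (C := C) (h p)) l) =
        h.flip (leftAct L f l) p := fun f p l => by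
    rw [hL, functional_contractRight]
    rfl
  constructor
  · intro hh f l p
    rw [← key', hh, key]
  · intro hh p
    refine dualTensor_injective hC (LinearMap.ext fun l => eq_of_forall_functional hright fun f => ?_)
    rw [key', hh, key]

end Dual

/-! ### Extension of colinear pairings -/

section Extension

theorem contractLeft_add {R C P : Type u} [Ring R] [AddCommGroup C] [Module R C]
    [AddCommGroup P] [Module Rᵐᵒᵖ P] (ξ η : P →ₗ[Rᵐᵒᵖ] R) (x : BTensor R P C) :
    contractLeft C (ξ + η) x = contractLeft C ξ x + contractLeft C η x := by
  induction x using BTensor.induction_on with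
  | tmul p c => exact add_smul _ _ _
  | add x y hx hy =>
    rw [map_add, hx, hy, map_add, map_add]
    abel

variable {R C : Type u} [Ring R]
  [AddCommGroup C] [Module R C] [Module Rᵐᵒᵖ C] [SMulCommClass R Rᵐᵒᵖ C] [Coring R C]

theorem rightColinear_id {M : Type u} [AddCommGroup M] [Module Rᵐᵒᵖ M] [RightComodule R C M] :
    RightColinear C (LinearMap.id : M →ₗ[Rᵐᵒᵖ] M) := fun _ => (map_id_id _).symm

/-- Colinear pairings with a projective comodule extend along inclusions of finitely generated
comodules. -/
theorem IsColinearPairing.exists_extension (hR : IsQFRing R) (hleft : Module.Projective R C)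
    (hright : Module.Projective Rᵐᵒᵖ C) (hC : IsSeparated R C)
    {P : Type u} [AddCommGroup P] [Module Rᵐᵒᵖ P] [RightComodule R C P]
    (hP : IsProjectiveRightComodule R C P)
    {L L' : Type u} [AddCommGroup L] [Module R L] [LeftComodule R C L] [Module.Finite R L]
    [AddCommGroup L'] [Module R L'] [LeftComodule R C L'] [Module.Finite R L']
    {ι : L' →ₗ[R] L} (hι : Function.Injective ι)
    (hιact : ∀ (f : C →ₗ[Rᵐᵒᵖ] R) (l : L'), leftAct L f (ι l) = ι (leftAct L' f l))
    {φ : L' →ₗ[R] P →ₗ[Rᵐᵒᵖ] R} (hφ : IsColinearPairing (C := C) φ) :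
    ∃ ψ : L →ₗ[R] P →ₗ[Rᵐᵒᵖ] R, IsColinearPairing (C := C) ψ ∧ ψ ∘ₗ ι = φ := by
  have hinj := hR.injective
  obtain ⟨_, hL⟩ := exists_isDualCoaction (L := L) hleft hC
  obtain ⟨_, hL'⟩ := exists_isDualCoaction (L := L') hleft hC
  let g : (L →ₗ[R] R) →ₗ[Rᵐᵒᵖ] (L' →ₗ[R] R) :=
    { toFun := fun ξ => ξ ∘ₗ ι
      map_add' := fun _ _ => rfl
      map_smul' := fun _ _ => rfl }
  have hg : Function.Surjective g := fun η =>
    Module.Injective.extension_property R R _ _ ι hι η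
  -- The pairing belonging to `g` is the evaluation pairing of `L`, which belongs to the identity,
  -- restricted along `ι`.
  have hgc : RightColinear C g := by
    refine (rightColinear_iff_isColinearPairing hright hC hL' g).2 fun f l ξ => ?_
    have h1 := (rightColinear_iff_isColinearPairing hright hC hL _).1 rightColinear_id f (ι l) ξ
    refine Eq.trans ?_ h1
    rw [hιact]
    rfl
  have hφc : RightColinear C φ.flip := (rightColinear_iff_isColinearPairing hright hC hL' _).2 hφ
  obtain ⟨k, hk, hgk⟩ := hP _ _ g φ.flip hgc hg hφc
  refine ⟨k.flip, (rightColinear_iff_isColinearPairing hright hC hL k).1 hk, ?_⟩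
  ext l p
  exact LinearMap.congr_fun (LinearMap.congr_fun hgk p) l

variable {M : Type u} [AddCommGroup M] [Module R M] [LeftComodule R C M]
  {P : Type u} [AddCommGroup P] [Module Rᵐᵒᵖ P] [RightComodule R C P]

variable (C) in
/-- Colinear pairings between a subcomodule of `M` and `P`. -/
def IsPartialColinearPairing (ψ : M →ₗ.[R] (P →ₗ[Rᵐᵒᵖ] R)) : Prop :=
  ∀ (f : C →ₗ[Rᵐᵒᵖ] R) (x : ψ.domain), ∃ h : leftAct M f x ∈ ψ.domain, ∀ p : P,
    ψ ⟨_, h⟩ p = f (contractLeft C (ψ x) (RightComodule.coact (R := R) (C := C) p))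

theorem IsColinearPairing.isPartialColinearPairing {L : Submodule R M} [LeftComodule R C L]
    (hL : LeftColinear C L.subtype) {φ : L →ₗ[R] P →ₗ[Rᵐᵒᵖ] R}
    (hφ : IsColinearPairing (C := C) φ) :
    IsPartialColinearPairing C (⟨L, φ⟩ : M →ₗ.[R] (P →ₗ[Rᵐᵒᵖ] R)) := fun f (x : L) => by
  have h1 : leftAct M f x = leftAct L f x := hL.map_leftAct f x
  refine ⟨h1 ▸ (leftAct L f x).2, fun p => (Eq.trans ?_ (hφ f x p))⟩
  exact LinearMap.congr_fun (congrArg φ (Subtype.ext h1)) p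

theorem IsPartialColinearPairing.sSup {c : Set (M →ₗ.[R] (P →ₗ[Rᵐᵒᵖ] R))} (hne : c.Nonempty)
    (hdir : DirectedOn (· ≤ ·) c) (hc : ∀ ψ ∈ c, IsPartialColinearPairing C ψ) :
    IsPartialColinearPairing C (LinearPMap.sSup c hdir) := fun f ⟨x, hx⟩ => by
  have hx' := hx
  rw [LinearPMap.domain_sSup, Submodule.mem_sSup_of_directed (hne.image _)
    (directedOn_image.2 fun a ha b hb =>
      let ⟨d, hd, had, hbd⟩ := hdir a ha b hb; ⟨d, hd, had.1, hbd.1⟩)] at hx'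
  obtain ⟨_, ⟨ψ, hψ, rfl⟩, hxψ⟩ := hx'
  obtain ⟨h, hp⟩ := hc ψ hψ f ⟨x, hxψ⟩
  have hle := LinearPMap.le_sSup hdir hψ
  refine ⟨hle.1 h, fun p => ?_⟩
  rw [← hle.2 (x := ⟨_, h⟩) (y := ⟨_, hle.1 h⟩) rfl, hp,
    hle.2 (x := ⟨x, hxψ⟩) (y := ⟨x, hx⟩) rfl]

theorem IsPartialColinearPairing.sup {ψ χ : M →ₗ.[R] (P →ₗ[Rᵐᵒᵖ] R)}
    (hψ : IsPartialColinearPairing C ψ) (hχ : IsPartialColinearPairing C χ)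
    (H : ∀ (x : ψ.domain) (y : χ.domain), (x : M) = y → ψ x = χ y) :
    IsPartialColinearPairing C (ψ.sup χ H) := fun f ⟨z, hz⟩ => by
  obtain ⟨x, hx, y, hy, rfl⟩ := Submodule.mem_sup.1 hz
  obtain ⟨hx', hpx⟩ := hψ f ⟨x, hx⟩
  obtain ⟨hy', hpy⟩ := hχ f ⟨y, hy⟩
  have hmem : leftAct M f (x + y) ∈ ψ.domain ⊔ χ.domain := by
    rw [map_add]
    exact Submodule.add_mem_sup hx' hy'
  refine ⟨hmem, fun p => ?_⟩
  rw [show ψ.sup χ H ⟨x + y, hz⟩ = ψ ⟨x, hx⟩ + χ ⟨y, hy⟩ from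
    LinearPMap.sup_apply H ⟨x, hx⟩ ⟨y, hy⟩ ⟨x + y, hz⟩ rfl]
  refine (LinearMap.congr_fun (LinearPMap.sup_apply H ⟨_, hx'⟩ ⟨_, hy'⟩ ⟨_, hmem⟩
    (map_add _ _ _).symm) p).trans ?_
  rw [LinearMap.add_apply, hpx, hpy, contractLeft_add, map_add]

/-- Enlarge the domain of a colinear pairing by a finitely generated subcomodule. -/
theorem IsPartialColinearPairing.exists_le (hR : IsQFRing R) (hleft : Module.Projective R C)
    (hright : Module.Projective Rᵐᵒᵖ C) (hC : IsSeparated R C)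
    (hP : IsProjectiveRightComodule R C P) {ψ : M →ₗ.[R] (P →ₗ[Rᵐᵒᵖ] R)}
    (hψ : IsPartialColinearPairing C ψ) (m : M) :
    ∃ χ, IsPartialColinearPairing C χ ∧ ψ ≤ χ ∧ m ∈ χ.domain := by
  have := hR.isNoetherian
  obtain ⟨L, hL, hfg, hm⟩ := exists_fg_leftSubcomodule hright m
  -- The overlap is finitely generated because `R` is left noetherian. Extending `ψ` from the
  -- overlap to all of `L` gives a map that glues with `ψ`.
  have hL' : IsLeftSubcomodule C (ψ.domain ⊓ L) :=
    isLeftSubcomodule_of_leftAct_mem hright fun f x hx =>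
      ⟨(hψ f ⟨x, hx.1⟩).1, hL.leftAct_mem f hx.2⟩
  obtain ⟨_, hLc⟩ := hL
  obtain ⟨_, hLc'⟩ := hL'
  have : IsNoetherian R L := isNoetherian_of_fg_of_noetherian L hfg
  have : IsNoetherian R ↥(ψ.domain ⊓ L) := isNoetherian_of_le inf_le_right
  have hact : ∀ (f : C →ₗ[Rᵐᵒᵖ] R) (l : ↥(ψ.domain ⊓ L)), leftAct M f l = leftAct _ f l :=
    hLc'.map_leftAct
  obtain ⟨φ, hφ, hext⟩ := IsColinearPairing.exists_extension (C := C) hR hleft hright hC hP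
    (ι := Submodule.inclusion (inf_le_right : ψ.domain ⊓ L ≤ L))
    (Submodule.inclusion_injective _)
    (fun f l => Subtype.ext ((hLc.map_leftAct f _).symm.trans (hact f l)))
    (φ := ψ.toFun ∘ₗ Submodule.inclusion inf_le_left) fun f l p => by
      obtain ⟨h, hp⟩ := hψ f ⟨l, l.2.1⟩
      refine Eq.trans ?_ (hp p)
      exact LinearMap.congr_fun (congrArg ψ.toFun (Subtype.ext (hact f l).symm)) p
  have H : ∀ (x : ψ.domain) (y : L), (x : M) = y → ψ x = φ y := fun ⟨x, hx⟩ ⟨y, hy⟩ hxy => by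
    obtain rfl : x = y := hxy
    exact (LinearMap.congr_fun hext ⟨x, hx, hy⟩).symm
  refine ⟨ψ.sup ⟨L, φ⟩ H, hψ.sup (hφ.isPartialColinearPairing hLc) H, LinearPMap.left_le_sup _ _ H, ?_⟩
  exact Submodule.mem_sup_right hm

theorem IsPartialColinearPairing.exists_total (hR : IsQFRing R) (hleft : Module.Projective R C)
    (hright : Module.Projective Rᵐᵒᵖ C) (hC : IsSeparated R C)
    (hP : IsProjectiveRightComodule R C P) {ψ : M →ₗ.[R] (P →ₗ[Rᵐᵒᵖ] R)}
    (hψ : IsPartialColinearPairing C ψ) :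
    ∃ Ψ : M →ₗ[R] P →ₗ[Rᵐᵒᵖ] R, IsColinearPairing (C := C) Ψ ∧ ∀ x : ψ.domain, Ψ x = ψ x := by
  obtain ⟨χ, hle, hχ⟩ := zorn_le_nonempty₀
    {χ : M →ₗ.[R] (P →ₗ[Rᵐᵒᵖ] R) | IsPartialColinearPairing C χ}
    (fun c hc hchain y hy => ⟨LinearPMap.sSup c hchain.directedOn,
      IsPartialColinearPairing.sSup ⟨y, hy⟩ _ hc, fun z hz => LinearPMap.le_sSup _ hz⟩) ψ hψ
  have htop : ∀ m, m ∈ χ.domain := fun m => by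
    obtain ⟨χ', hχ', hle', hm⟩ :=
      IsPartialColinearPairing.exists_le hR hleft hright hC hP hχ.prop m
    exact (hχ.2 hχ' hle').1 hm
  refine ⟨χ.toFun ∘ₗ LinearMap.codRestrict χ.domain LinearMap.id htop, fun f m p => ?_,
    fun x => (hle.2 rfl).symm⟩
  exact (hχ.prop f ⟨m, htop m⟩).2 p

end Extension

/-! ### Simple right comodules and their projective covers -/

section Simple

variable {R C : Type u} [Ring R]
  [AddCommGroup C] [Module R C] [Module Rᵐᵒᵖ C] [SMulCommClass R Rᵐᵒᵖ C] [Coring R C]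

theorem exists_simple_rightSubcomodule (hleft : Module.Projective R C) (hC : IsSeparated R C)
    (N : Type u) [AddCommGroup N] [Module Rᵐᵒᵖ N] [RightComodule R C N] [IsArtinian Rᵐᵒᵖ N]
    [Nontrivial N] :
    ∃ (T : Submodule Rᵐᵒᵖ N) (_ : RightComodule R C T), RightColinear C T.subtype ∧
      IsSimpleRightComodule R C T := by
  obtain ⟨T, ⟨hT, hT0⟩, hmin⟩ := IsArtinian.set_has_minimal
    {T : Submodule Rᵐᵒᵖ N | IsRightSubcomodule C T ∧ T ≠ ⊥}
    ⟨⊤, isRightSubcomodule_of_rightAct_mem hleft hC fun _ _ _ => Submodule.mem_top, top_ne_bot⟩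
  obtain ⟨_, hTc⟩ := hT
  refine ⟨T, _, hTc, Submodule.nontrivial_iff_ne_bot.2 hT0, fun A hA => ?_⟩
  by_contra! hA'
  refine hmin (A.map T.subtype) ⟨isRightSubcomodule_of_rightAct_mem hleft hC ?_, fun h => hA'.1 ?_⟩
    (lt_of_le_of_ne (Submodule.map_subtype_le T A) fun h => hA'.2 ?_)
  · rintro f _ ⟨a, ha, rfl⟩
    exact ⟨_, hA.rightAct_mem f ha, (hTc.map_rightAct f a).symm⟩
  · exact Submodule.map_injective_of_injective T.subtype_injective (by rw [h, Submodule.map_bot])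
  · refine Submodule.map_injective_of_injective T.subtype_injective ?_
    rw [h, Submodule.map_subtype_top]

/-- A projective cover of a simple comodule is finitely generated. -/
theorem finite_of_projectiveCover (hleft : Module.Projective R C) (hC : IsSeparated R C)
    {T P : Type u} [AddCommGroup T] [Module Rᵐᵒᵖ T] [RightComodule R C T]
    [AddCommGroup P] [Module Rᵐᵒᵖ P] [RightComodule R C P] (hT : IsSimpleRightComodule R C T)
    {f : P →ₗ[Rᵐᵒᵖ] T} (hf : RightColinear C f) (hsurj : Function.Surjective f)
    (hsmall : IsSmallRightSubcomodule C (LinearMap.ker f)) : Module.Finite Rᵐᵒᵖ P := by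
  have := hT.1
  obtain ⟨t, ht⟩ := exists_ne (0 : T)
  obtain ⟨p, rfl⟩ := hsurj t
  obtain ⟨P₀, hP₀, hfg, hp⟩ := exists_fg_rightSubcomodule hleft hC p
  -- The image is a nonzero subcomodule of a simple comodule. Hence `P₀` and `ker f` span `P`, and
  -- smallness forces `P₀ = P`.
  have hmap : P₀.map f = ⊤ := by
    refine (hT.2 _ (isRightSubcomodule_of_rightAct_mem hleft hC ?_)).resolve_left fun h => ht ?_
    · rintro g _ ⟨a, ha, rfl⟩
      exact ⟨_, hP₀.rightAct_mem g ha, (hf.map_rightAct g a).symm⟩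
    · exact (Submodule.eq_bot_iff _).1 h _ (Submodule.mem_map_of_mem hp)
  have htop : P₀ = ⊤ := hsmall.2 P₀ hP₀ <| by
    rw [sup_comm, ← Submodule.comap_map_eq, hmap, Submodule.comap_top]
  exact ⟨htop ▸ hfg⟩

end Simple

/-! ### Maximal subcomodules -/

section Maximal

variable {R C : Type u} [Ring R]
  [AddCommGroup C] [Module R C] [Module Rᵐᵒᵖ C] [SMulCommClass R Rᵐᵒᵖ C] [Coring R C]

/-- Evaluation on a finite generating set embeds the dual in a finite power of `R`. -/
theorem isNoetherian_dual [IsNoetherian R R] (P : Type u) [AddCommGroup P] [Module Rᵐᵒᵖ P]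
    [Module.Finite Rᵐᵒᵖ P] : IsNoetherian R (P →ₗ[Rᵐᵒᵖ] R) := by
  obtain ⟨G, hG⟩ := (Module.finite_def (R := Rᵐᵒᵖ) (M := P)).1 inferInstance
  let e : (P →ₗ[Rᵐᵒᵖ] R) →ₗ[R] (G → R) :=
    { toFun := fun ξ p => ξ p
      map_add' := fun _ _ => rfl
      map_smul' := fun _ _ => rfl }
  exact isNoetherian_of_injective e fun ξ η h =>
    LinearMap.ext_on hG fun p hp => congrFun h ⟨p, hp⟩

theorem isArtinian_dual [IsArtinian Rᵐᵒᵖ R] (L : Type u) [AddCommGroup L] [Module R L]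
    [Module.Finite R L] : IsArtinian Rᵐᵒᵖ (L →ₗ[R] R) := by
  obtain ⟨G, hG⟩ := (Module.finite_def (R := R) (M := L)).1 inferInstance
  let e : (L →ₗ[R] R) →ₗ[Rᵐᵒᵖ] (G → R) :=
    { toFun := fun ξ p => ξ p
      map_add' := fun _ _ => rfl
      map_smul' := fun _ _ => rfl }
  exact isArtinian_of_injective e fun ξ η h =>
    LinearMap.ext_on hG fun p hp => congrFun h ⟨p, hp⟩

variable {M : Type u} [AddCommGroup M] [Module R M] [LeftComodule R C M]

theorem IsColinearPairing.isLeftSubcomodule_ker (hright : Module.Projective Rᵐᵒᵖ C)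
    {P : Type u} [AddCommGroup P] [Module Rᵐᵒᵖ P] [RightComodule R C P]
    {Ψ : M →ₗ[R] P →ₗ[Rᵐᵒᵖ] R} (hΨ : IsColinearPairing (C := C) Ψ) :
    IsLeftSubcomodule C (LinearMap.ker Ψ) :=
  isLeftSubcomodule_of_leftAct_mem hright fun f m hm => LinearMap.ext fun p => by
    have h0 : ∀ x : BTensor R P C, contractLeft C (0 : P →ₗ[Rᵐᵒᵖ] R) x = 0 := fun x => by
      simpa using contractLeft_add 0 0 x
    rw [hΨ, LinearMap.mem_ker.1 hm, h0, map_zero, LinearMap.zero_apply]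

theorem exists_isMaximalLeftSubcomodule (hR : IsQFRing R) (hleft : Module.Projective R C)
    (hright : Module.Projective Rᵐᵒᵖ C) (hC : IsRightSemiperfect R C)
    (M : Type u) [AddCommGroup M] [Module R M] [LeftComodule R C M] [Nontrivial M] :
    ∃ N : Submodule R M, IsMaximalLeftSubcomodule C N := by
  have hα : IsSeparated R C := hC.1
  have := hR.1
  have := hR.isNoetherian
  obtain ⟨m, hm⟩ := exists_ne (0 : M)
  obtain ⟨L, ⟨_, hL⟩, hfg, hmL⟩ := exists_fg_leftSubcomodule hright m
  have : Module.Finite R L := Module.Finite.iff_fg.2 hfg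
  obtain ⟨_, hdual⟩ := exists_isDualCoaction (L := L) hleft hα
  have := isArtinian_dual (R := R) L
  obtain ⟨ξ, hξ⟩ := hR.exists_functional_ne_zero (l := (⟨m, hmL⟩ : L))
    fun h => hm (congrArg Subtype.val h)
  have : Nontrivial (L →ₗ[R] R) := ⟨ξ, 0, fun h => hξ (by rw [h, LinearMap.zero_apply])⟩
  obtain ⟨T, _, hTc, hT⟩ := exists_simple_rightSubcomodule hleft hα (L →ₗ[R] R)
  obtain ⟨P, _, _, _, f, hP, hf, hsurj, hsmall⟩ := hC.2 T hT
  have := finite_of_projectiveCover hleft hα hT hf hsurj hsmall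
  have := isNoetherian_dual (R := R) P
  have hcol : RightColinear C (T.subtype ∘ₗ f) := fun p => by
    rw [LinearMap.comp_apply, hTc, hf, map_map]
    rfl
  have hφ := (rightColinear_iff_isColinearPairing hright hα hdual _).1 hcol
  obtain ⟨Ψ, hΨ, hext⟩ :=
    (hφ.isPartialColinearPairing hL).exists_total hR hleft hright hα hP
  -- On `L` the values `Ψ l p` are those of the functional `f p ∈ T`, and a nonzero `t = f p` is
  -- nonzero at some `l`.
  have hne : LinearMap.ker Ψ ≠ ⊤ := fun h => by
    have := hT.1
    obtain ⟨t, ht⟩ := exists_ne (0 : T)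
    obtain ⟨p, rfl⟩ := hsurj t
    refine ht (Subtype.ext (LinearMap.ext fun l => ?_))
    have h1 : Ψ l = 0 := LinearMap.mem_ker.1 (h ▸ Submodule.mem_top)
    exact LinearMap.congr_fun ((hext l).symm.trans h1) p
  -- Submodules containing `ker Ψ` are determined by their images in the noetherian module `Hom_R(P,
  -- R)`, so a maximal image comes from a maximal subcomodule.
  obtain ⟨_, ⟨N, ⟨hN, hKN, hNtop⟩, rfl⟩, hmax⟩ := set_has_maximal_iff_noetherian.2 this
    ((Submodule.map Ψ) ''
      {N | IsLeftSubcomodule C N ∧ LinearMap.ker Ψ ≤ N ∧ N ≠ ⊤})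
    ⟨_, _, ⟨hΨ.isLeftSubcomodule_ker hright, le_rfl, hne⟩, rfl⟩
  refine ⟨N, ⟨hN, hNtop⟩, fun N' hN' hle => ?_⟩
  have hle' : N.map Ψ ≤ N'.map Ψ := Submodule.map_mono hle
  have heq : N'.map Ψ ≤ N.map Ψ := by
    by_contra h
    exact hmax _ ⟨N', ⟨hN'.1, hKN.trans hle, hN'.2⟩, rfl⟩ (lt_of_le_not_ge hle' h)
  rw [Submodule.map_le_iff_le_comap, Submodule.comap_map_eq, sup_eq_left.2 hKN] at heq
  exact heq

theorem isLeftSubcomodule_leftComoduleRadical (hright : Module.Projective Rᵐᵒᵖ C) :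
    IsLeftSubcomodule C (leftComoduleRadical R C M) :=
  isLeftSubcomodule_of_leftAct_mem hright fun f m hm => by
    rw [leftComoduleRadical, Submodule.mem_sInf] at hm ⊢
    exact fun N hN => hN.1.1.leftAct_mem f (hm N hN)

/-- Maximal subcomodules of a quotient comodule pull back to maximal subcomodules. -/
theorem IsMaximalLeftSubcomodule.comap_mkQ (hright : Module.Projective Rᵐᵒᵖ C)
    {L : Submodule R M} [LeftComodule R C (M ⧸ L)] (hL : LeftColinear C L.mkQ)
    {N : Submodule R (M ⧸ L)} (hN : IsMaximalLeftSubcomodule C N) :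
    IsMaximalLeftSubcomodule C (N.comap L.mkQ) := by
  refine ⟨⟨isLeftSubcomodule_of_leftAct_mem hright fun f m hm => ?_, fun h => hN.prop.2 ?_⟩,
    fun N' hN' hle => ?_⟩
  · rw [Submodule.mem_comap, ← hL.map_leftAct]
    exact hN.prop.1.leftAct_mem f hm
  · rw [← Submodule.map_comap_eq_of_surjective L.mkQ_surjective N, h, Submodule.map_top,
      L.range_mkQ]
  · have hLN' : L ≤ N' := (L.le_comap_mkQ N).trans hle
    have hcm : (N'.map L.mkQ).comap L.mkQ = N' := by
      rw [Submodule.comap_map_mkQ, sup_eq_right.2 hLN']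
    rw [← Submodule.map_le_iff_le_comap]
    refine hN.2 ⟨isLeftSubcomodule_of_leftAct_mem hright ?_, fun h => hN'.2 ?_⟩ ?_
    · rintro f _ ⟨a, ha, rfl⟩
      exact ⟨_, hN'.1.leftAct_mem f ha, (hL.map_leftAct f a).symm⟩
    · rw [← hcm, h, Submodule.comap_top]
    · rw [← Submodule.map_comap_eq_of_surjective L.mkQ_surjective N]
      exact Submodule.map_mono hle

end Maximal

end CoringTheory

theorem lemma4p4 (R C : Type u) [Ring R]
    [AddCommGroup C] [Module R C] [Module Rᵐᵒᵖ C] [SMulCommClass R Rᵐᵒᵖ C]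
    [CoringTheory.Coring R C]
    (hR : CoringTheory.IsQFRing R)
    (hleft : Module.Projective R C) (hright : Module.Projective Rᵐᵒᵖ C)
    (hC : CoringTheory.IsRightSemiperfect R C)
    (M : Type u) [AddCommGroup M] [Module R M] [CoringTheory.LeftComodule R C M]
    [Nontrivial M] :
    (∃ N : Submodule R M, CoringTheory.IsMaximalLeftSubcomodule C N) ∧
      CoringTheory.IsSmallLeftSubcomodule C (CoringTheory.leftComoduleRadical R C M) := by
  refine ⟨CoringTheory.exists_isMaximalLeftSubcomodule hR hleft hright hC M,
    CoringTheory.isLeftSubcomodule_leftComoduleRadical hright, fun L hL hsup => ?_⟩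
  by_contra hne
  obtain ⟨_, hπ⟩ := CoringTheory.exists_leftComodule_quotient hL
  have : Nontrivial (M ⧸ L) := Submodule.Quotient.nontrivial_iff.2 hne
  -- The preimage of `N` is a maximal subcomodule of `M` containing both `L` and the radical, hence
  -- all of `M`, which is absurd.
  obtain ⟨N, hN⟩ := CoringTheory.exists_isMaximalLeftSubcomodule hR hleft hright hC (M ⧸ L)
  have hmax := hN.comap_mkQ hright hπ
  refine hmax.prop.2 (top_le_iff.1 (hsup ▸ sup_le ?_ (L.le_comap_mkQ N)))
  exact sInf_le hmax
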